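/- Let $\mathfrak r^i=\mathbb R[[x_i,\dots,x_3]]$ for $i=1,2,3$. Let $\mathfrak t$ be the space of feed-forward formal vector fields $V=\sum_{i=1}^3V_i\,\partial/\partial x_i$ with $V_i\in\mathfrak r^i$, let $\mathfrak t_1\subset\mathfrak t$ be the set of those without constant and linear terms, and let $\mathfrak r_1$ be the set of triples $r=(r^1,r^2,r^3)$ with $r^i\in\mathfrak r^i$ and $r^i(0)=0$. For such $r$ and $X\in\mathfrak t_1$ let $\rho(r,X)Y=r\star Y+[X,Y]$, where $r\star Y=\sum_i r^iY_i\,\partial/\partial x_i$ and $[X,Y]_i=\sum_j\bigl(X_j\,\partial Y_i/\partial x_j-Y_j\,\partial X_i/\partial x_j\bigr)$, and let $\exp\rho(r,X)=\sum_{k\ge 0}\rho(r,X)^k/k!$, which is a well-defined operator on $\mathfrak t$ because $\rho(r,X)$ raises the degree. Thus $\exp\rho(0,X)$ is a formal near-identity feed-forward change of coordinates, and $\exp\rho(r,0)$ multiplies the $i$-th component by $e^{r^i}$, i.e. rescales time separately in each component. Consider the feed-forward system $$\dot x_1=x_2+F_1(x_1,x_2,x_3),\qquad \dot x_2=x_3+F_2(x_2,x_3),\qquad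 \dot x_3=F_3(x_3),$$ where $F_i\in\mathfrak r^i$ has no constant and no linear terms, and let $V\in\mathfrak t$ be its vector field. Let $a_2,b_2,c_2$ be the coefficients of $x_1^2$ in $F_1$, of $x_2^2$ in $F_2$ and of $x_3^2$ in $F_3$, and assume that $a_2,b_2,c_2$ are all nonzero. For $a,b,c\in\mathbb R$ let $W_{a,b,c}$ be the vector field of $$\dot x_1=x_2+a\,x_1^2,\qquad \dot x_2=x_3+b\,x_2^2,\qquad \dot x_3=c\,x_3^2.$$ (i) There are $X\in\mathfrak t_1$ and $r\in\mathfrak r_1$ such that $$\exp\rho(r,0)\,\exp\rho(0,X)\,V=W_{a_2,b_2,c_2}.$$ Here $\exp\rho(r,0)\exp\rho(0,X)$ is a bijection of $\mathfrak t$, and $\exp\rho(0,X)$ is the change of coordinates by an invertible formal feed-forward map: there are mutually inverse formal maps $\varphi,\psi$ with $\varphi_i,\psi_i\in\mathfrak r^i$ and $\varphi_i-x_i$, $\psi_i-x_i$ of order at least $2$, such that for every $U\in\mathfrak t$ the field $U'=\exp\rho(0,X)U$ satisfies $U'_i(\varphi(x))=\sum_jU_j(x)\,\partial\varphi_i/\partial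 x_j(x)$ for $i=1,2,3$. (ii) The normal form is unique: if $V$ can be brought to $W_{a,b,c}$ by finitely many transformations $\exp\rho(r,X)$ with $r\in\mathfrak r_1$ and $X\in\mathfrak t_1$, then $a=a_2$, $b=b_2$, $c=c_2$. -/

import Mathlib

noncomputable section

namespace FeedForward

/-- Formal power series in `x₁, …, xₙ` (indexed by `Fin n`, so `x₁` has index `0`). -/
abbrev Series (n : ℕ) : Type := MvPowerSeries (Fin n) ℝ

/-- `ℝ[[xᵢ, …, xₙ]]`: only variables with index at least `i` occur. -/
def ringFrom {n : ℕ} (i : Fin n) : Set (Series n) :=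
  {f | ∀ d : Fin n →₀ ℕ, MvPowerSeries.coeff d f ≠ 0 → ∀ j, j < i → d j = 0}

/-- Feed-forward (triangular) formal vector fields `∑ᵢ Vᵢ ∂/∂xᵢ` with
`Vᵢ ∈ ℝ[[xᵢ, …, xₙ]]`. -/
def fields (n : ℕ) : Set (Fin n → Series n) :=
  {V | ∀ i, V i ∈ ringFrom i}

/-- Feed-forward formal vector fields without constant and linear terms:
the generators of near-identity coordinate changes. -/
def fieldsOne (n : ℕ) : Set (Fin n → Series n) :=
  {X | X ∈ fields n ∧ ∀ i, 2 ≤ (X i).order}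

/-- Generators of orbital transformations: one function `rᵢ ∈ ℝ[[xᵢ, …, xₙ]]` without constant
term for each component. -/
def orbitalOne (n : ℕ) : Set (Fin n → Series n) :=
  {r | ∀ i, r i ∈ ringFrom i ∧ MvPowerSeries.constantCoeff (r i) = 0}

/-- The derivative `V(f) = ∑ⱼ Vⱼ ∂f/∂xⱼ` of `f` along `V`. -/
def along {n : ℕ} (V : Fin n → Series n) (f : Series n) : Series n :=
  ∑ j, V j * MvPowerSeries.pderiv ℝ j f

/-- The Lie bracket of formal vector fields, `[X, Y]ᵢ = X(Yᵢ) - Y(Xᵢ)`. -/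
def bracket {n : ℕ} (X Y : Fin n → Series n) : Fin n → Series n :=
  fun i => along X (Y i) - along Y (X i)

/-- `ρ(r, X) Y = r ⋆ Y + [X, Y]`, where `r ⋆ Y` multiplies the `i`-th component of `Y`
by `rᵢ`. -/
def rho {n : ℕ} (r X Y : Fin n → Series n) : Fin n → Series n :=
  fun i => r i * Y i + bracket X Y i

/-- `exp(ρ(r, X)) V = ∑ₖ ρ(r, X)ᵏ V / k!`, coefficient by coefficient. For `r ∈ orbitalOne n` and
`X ∈ fieldsOne n` the operator `ρ(r, X)` raises the degree, so that only finitely many `k`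
contribute to each coefficient. -/
def expRho {n : ℕ} (r X V : Fin n → Series n) : Fin n → Series n :=
  fun i d => ∑ᶠ k : ℕ, ((k.factorial : ℝ)⁻¹) * MvPowerSeries.coeff d (((rho r X)^[k] V) i)

/-- `V'` is obtained from `V` by one transformation `exp(ρ(r, X))`. -/
def OuterStep {n : ℕ} (V V' : Fin n → Series n) : Prop :=
  ∃ r ∈ orbitalOne n, ∃ X ∈ fieldsOne n, V' = expRho r X V

/-- Near-identity feed-forward formal maps `y = φ(x)`, `φᵢ = xᵢ + (order ≥ 2)` in
`ℝ[[xᵢ, …, xₙ]]`. -/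
def maps (n : ℕ) : Set (Fin n → Series n) :=
  {φ | ∀ i, φ i ∈ ringFrom i ∧ 2 ≤ (φ i - MvPowerSeries.X i).order}

/-- `φ` and `ψ` are mutually inverse formal maps. -/
def AreInverse {n : ℕ} (φ ψ : Fin n → Series n) : Prop :=
  ∀ i, MvPowerSeries.subst φ (ψ i) = MvPowerSeries.X i ∧
    MvPowerSeries.subst ψ (φ i) = MvPowerSeries.X i

/-- The coordinate change `y = φ(x)` turns `ẋ = V(x)` into `ẏ = V'(y)`:
`V'ᵢ(φ(x)) = ∑ⱼ Vⱼ(x) ∂φᵢ/∂xⱼ(x)`. -/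
def TurnsInto {n : ℕ} (φ V V' : Fin n → Series n) : Prop :=
  ∀ i, MvPowerSeries.subst φ (V' i) = along V (φ i)

/-- The system `ẋ₁ = x₂ + F₁`, `ẋ₂ = x₃ + F₂`, `ẋ₃ = F₃`. -/
def system (F₁ F₂ F₃ : Series 3) : Fin 3 → Series 3 :=
  ![MvPowerSeries.X 1 + F₁, MvPowerSeries.X 2 + F₂, F₃]

/-- The system `ẋ₁ = x₂ + a x₁²`, `ẋ₂ = x₃ + b x₂²`, `ẋ₃ = c x₃²`. -/
def normalForm (a b c : ℝ) : Fin 3 → Series 3 :=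
  system (MvPowerSeries.C a * MvPowerSeries.X 0 ^ 2) (MvPowerSeries.C b * MvPowerSeries.X 1 ^ 2)
    (MvPowerSeries.C c * MvPowerSeries.X 2 ^ 2)

end FeedForward

end

/-! Existence amounts to finding a near-identity feed-forward map `φ` and units `u i` with constant
term 1 such that V(φᵢ) = uᵢ · (Wᵢ ∘ φ), where W is the normal form. Such a `φ` is the time-one flow
of a formal feed-forward field, so it is a coordinate change `exp ρ(0, X)`. After it, the i-th
component is `w i` times Wᵢ with `w i` = uᵢ ∘ φ⁻¹, and a family with constant terms 1 is removed by
some `exp ρ(r, 0)`.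

The equations are solved from the bottom up. In the last component φ₃ = x₃, and F₃ = c₂ x₃² u₃ with
u₃ a unit because c₂ ≠ 0. The other two have the form V(φ) = u (φ' + a φ²), with φ' the component
already found (`exists_along_eq`), and are solved degree by degree. Error terms divisible by the
next variable are absorbed in u. In the first component, a term x₃A is first traded, through V(x₂) =
x₃ + ⋯, for terms that are multiples of x₂ or of higher degree. A pure power of xᵢ is out of reach
of these moves. It is removed by adding to φ and u matched powers of xᵢ, whose net effect on its
coefficient is multiplication of the added coefficient by −2a; this is where a ≠ 0 enters
(`exists_residual_coeff_eq_zero`).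

Uniqueness holds because the coefficient of xᵢ² in the i-th component is invariant under every `exp
ρ(r, X)`: to second order the change is ρ(r, X) applied to the linear part, and this contains no
such term (`coeff_rho_linear`).

All convergence questions are settled once, in an abstract space with a complete filtration. -/

noncomputable section

namespace FeedForward

open Finset

/-! ### Exponentials of degree-raising operators on completely filtered spaces -/

section Filtration

variable {E : Type*} [AddCommGroup E] [Module ℝ E]

/-- A decreasing exhaustive filtration by subspaces that is separated and complete. -/
structure IsCompleteFiltration (F : ℕ → Submodule ℝ E) : Prop where
  anti : Antitone F
  zero : F 0 = ⊤
  separated : ∀ f, (∀ N, f ∈ F N) → f = 0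
  complete : ∀ s : ℕ → E, (∀ N, s (N + 1) - s N ∈ F N) → ∃ l, ∀ N, l - s N ∈ F N

/-- The subspace `C` contains the limits of its convergent sequences. -/
def IsClosedFor (F : ℕ → Submodule ℝ E) (C : Submodule ℝ E) : Prop :=
  ∀ l, (∀ N, ∃ c ∈ C, l - c ∈ F N) → l ∈ C

/-- The operator `T` raises the filtration degree by at least one. -/
def Raises (F : ℕ → Submodule ℝ E) (T : E →ₗ[ℝ] E) : Prop :=
  ∀ N, ∀ f ∈ F N, T f ∈ F (N + 1)

/-- Partial sums of the exponential series. -/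
def expSum (T : E →ₗ[ℝ] E) (f : E) (N : ℕ) : E :=
  ∑ k ∈ range N, ((k.factorial : ℝ)⁻¹) • (T ^ k) f

/-- `e` is the sum of the exponential series of `T` applied to `f`. -/
def IsExp (F : ℕ → Submodule ℝ E) (T : E →ₗ[ℝ] E) (f e : E) : Prop :=
  ∀ N, e - expSum T f N ∈ F N

variable {F : ℕ → Submodule ℝ E} {T : E →ₗ[ℝ] E}

lemma IsCompleteFiltration.eq_of_sub_mem (hF : IsCompleteFiltration F) {f g : E}
    (h : ∀ N, f - g ∈ F N) : f = g :=
  sub_eq_zero.1 (hF.separated _ h)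

lemma IsExp.unique (hF : IsCompleteFiltration F) {f e e' : E} (h : IsExp F T f e)
    (h' : IsExp F T f e') : e = e' :=
  hF.eq_of_sub_mem fun N => by simpa using (F N).sub_mem (h N) (h' N)

lemma Raises.pow_mem (hT : Raises F T) {N : ℕ} {f : E} (hf : f ∈ F N) (k : ℕ) :
    (T ^ k) f ∈ F (N + k) := by
  induction k with
  | zero => simpa using hf
  | succ k ih => rw [pow_succ', Module.End.mul_apply]; exact hT _ _ ih

lemma Raises.pow_mem_self (hF : IsCompleteFiltration F) (hT : Raises F T) (f : E) (k : ℕ) :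
    (T ^ k) f ∈ F k := by
  have h : f ∈ F 0 := by simp [hF.zero]
  simpa using hT.pow_mem h k

lemma Raises.neg (hT : Raises F T) : Raises F (-T) := fun N f hf => by
  simpa using (F (N + 1)).neg_mem (hT N f hf)

lemma exists_isExp (hF : IsCompleteFiltration F) (hT : Raises F T) (f : E) :
    ∃ e, IsExp F T f e := by
  refine hF.complete (expSum T f) fun N => ?_
  rw [expSum, expSum, sum_range_succ, add_sub_cancel_left]
  exact (F N).smul_mem _ (hT.pow_mem_self hF f N)

lemma IsExp.mem_of_isClosedFor {C : Submodule ℝ E} (hC : IsClosedFor F C)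
    (hT : ∀ f ∈ C, T f ∈ C) {f e : E} (hf : f ∈ C) (he : IsExp F T f e) : e ∈ C := by
  refine hC _ fun N => ⟨_, ?_, he N⟩
  have hpow : ∀ k, (T ^ k) f ∈ C := fun k => by
    induction k with
    | zero => simpa using hf
    | succ k ih => rw [pow_succ', Module.End.mul_apply]; exact hT _ ih
  exact C.sum_mem fun k _ => C.smul_mem _ (hpow k)

lemma IsExp.add {f g e e' : E} (h : IsExp F T f e)
    (h' : IsExp F T g e') : IsExp F T (f + g) (e + e') := fun N => by
  have : expSum T (f + g) N = expSum T f N + expSum T g N := by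
    simp [expSum, sum_add_distrib]
  rw [this, add_sub_add_comm]
  exact (F N).add_mem (h N) (h' N)

lemma IsExp.mem (hF : IsCompleteFiltration F) (hT : Raises F T) {N : ℕ} {f e : E}
    (hf : f ∈ F N) (he : IsExp F T f e) : e ∈ F N := by
  have h : expSum T f N ∈ F N := (F N).sum_mem fun k _ => (F N).smul_mem _
    (hF.anti (Nat.le_add_right N k) (hT.pow_mem hf k))
  simpa using (F N).add_mem (he N) h

/-- The square partial sums of a double series agree with its Cauchy partial sums up to terms
of high degree. -/
lemma sum_sum_sub_sum_antidiagonal_mem (hF : IsCompleteFiltration F) (h : ℕ → ℕ → E)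
    (hh : ∀ j l, h j l ∈ F (j + l)) (N : ℕ) :
    (∑ j ∈ range N, ∑ l ∈ range N, h j l) -
      ∑ k ∈ range N, ∑ p ∈ antidiagonal k, h p.1 p.2 ∈ F N := by
  have key : ∑ k ∈ range N, ∑ p ∈ antidiagonal k, h p.1 p.2 =
      ∑ p ∈ (range N ×ˢ range N).filter (fun p => p.1 + p.2 < N), h p.1 p.2 := by
    rw [← sum_fiberwise_of_maps_to (s := (range N ×ˢ range N).filter (fun p => p.1 + p.2 < N))
      (t := range N) (g := fun p => p.1 + p.2) (by simp)]
    refine sum_congr rfl fun k hk => sum_congr ?_ fun _ _ => rfl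
    ext p
    simp only [HasAntidiagonal.mem_antidiagonal, mem_filter, mem_product, mem_range] at hk ⊢
    omega
  rw [← sum_product', key, ← sum_filter_add_sum_filter_not (range N ×ˢ range N)
    (fun p => p.1 + p.2 < N), add_sub_cancel_left]
  refine (F N).sum_mem fun p hp => hF.anti ?_ (hh p.1 p.2)
  simpa using (mem_filter.1 hp).2

/-- The composite `exp T₁ ∘ V ∘ exp T₂` is the sum of the Cauchy product of the two series. -/
lemma IsExp.comp_sub_mem (hF : IsCompleteFiltration F) {T₁ T₂ V : E →ₗ[ℝ] E}
    (hT₁ : Raises F T₁) (hV : ∀ N, ∀ f ∈ F (N + 1), V f ∈ F N) {x e e' : E}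
    (hx : ∀ l, V ((T₂ ^ l) x) ∈ F l) (he : IsExp F T₂ x e) (he' : IsExp F T₁ (V e) e') (N : ℕ) :
    e' - ∑ k ∈ range N, ∑ p ∈ antidiagonal k,
      (((p.1.factorial : ℝ)⁻¹) * ((p.2.factorial : ℝ)⁻¹)) •
        (T₁ ^ p.1) (V ((T₂ ^ p.2) x)) ∈ F N := by
  have h₁ := sum_sum_sub_sum_antidiagonal_mem hF
    (fun j l => (((j.factorial : ℝ)⁻¹) * ((l.factorial : ℝ)⁻¹)) • (T₁ ^ j) (V ((T₂ ^ l) x)))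
    (fun j l => (F _).smul_mem _ (by simpa [add_comm] using hT₁.pow_mem (hx l) j)) N
  -- `V` may lose one degree, so the remainder of the inner series is taken at `N + 1`; the extra
  -- summand `l = N` is then put back by `hx`.
  have h₂ : V e - ∑ l ∈ range N, ((l.factorial : ℝ)⁻¹) • V ((T₂ ^ l) x) ∈ F N := by
    have := hV N _ (he (N + 1))
    rw [expSum, map_sub, map_sum, sum_range_succ, ← sub_sub] at this
    simp only [map_smul] at this
    simpa using (F N).add_mem this ((F N).smul_mem ((N.factorial : ℝ)⁻¹) (hx N))
  have h₃ : expSum T₁ (V e) N - ∑ j ∈ range N, ∑ l ∈ range N,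
      (((j.factorial : ℝ)⁻¹) * ((l.factorial : ℝ)⁻¹)) • (T₁ ^ j) (V ((T₂ ^ l) x)) ∈ F N := by
    rw [expSum, ← sum_sub_distrib]
    refine (F N).sum_mem fun j _ => ?_
    have := (F N).smul_mem ((j.factorial : ℝ)⁻¹)
      (hF.anti (Nat.le_add_right N j) (hT₁.pow_mem h₂ j))
    simpa [map_sub, map_sum, smul_sub, smul_sum, smul_smul] using this
  have := (F N).add_mem ((F N).add_mem (he' N) h₃) h₁
  simpa using this

/-- The binomial theorem for divided powers. -/
lemma _root_.Commute.inv_factorial_smul_add_pow {A : Type*} [Ring A] [Algebra ℝ A] {a b : A}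
    (h : Commute a b) (k : ℕ) :
    ((k.factorial : ℝ)⁻¹) • (a + b) ^ k = ∑ p ∈ antidiagonal k,
      (((p.1.factorial : ℝ)⁻¹) * ((p.2.factorial : ℝ)⁻¹)) • (a ^ p.1 * b ^ p.2) := by
  rw [h.add_pow', smul_sum]
  refine sum_congr rfl fun p hp => ?_
  obtain rfl := HasAntidiagonal.mem_antidiagonal.1 hp
  rw [← Nat.cast_smul_eq_nsmul ℝ, smul_smul, ← Nat.add_choose_mul_factorial_mul_factorial]
  congr 1
  rw [Nat.choose_symm_add]
  have := (Nat.choose_pos (Nat.le_add_left p.2 p.1)).ne'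
  have := Nat.factorial_ne_zero p.1
  have := Nat.factorial_ne_zero p.2
  push_cast
  field_simp

/-- The Cauchy product of the two series has k-th term (−T + T)ᵏ f / k!, which vanishes for k > 0.
This is the source of every inverse used below. -/
lemma IsExp.neg_comp (hF : IsCompleteFiltration F) (hT : Raises F T) {f e : E}
    (he : IsExp F T f e) : IsExp F (-T) e f := by
  obtain ⟨e', he'⟩ := exists_isExp hF hT.neg e
  suffices e' = f from this ▸ he'
  refine hF.eq_of_sub_mem fun N => ?_
  -- The estimate is taken at `N + 1` so that the range contains 0, the only index with a nonzero
  -- term.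
  have h := IsExp.comp_sub_mem hF hT.neg (V := LinearMap.id)
    (fun N f hf => hF.anti N.le_succ hf) (fun l => hT.pow_mem_self hF f l) he he' (N + 1)
  have key : ∀ k, ∑ p ∈ antidiagonal k, (((p.1.factorial : ℝ)⁻¹) * ((p.2.factorial : ℝ)⁻¹)) •
      ((-T) ^ p.1) (LinearMap.id (R := ℝ) ((T ^ p.2) f)) = if k = 0 then f else 0 := by
    intro k
    have h₁ : ((k.factorial : ℝ)⁻¹) • ((-T + T) ^ k) f = if k = 0 then f else 0 := by
      rcases k with _ | k <;> simp
    rw [← h₁, ← LinearMap.smul_apply, (Commute.refl T).neg_left.inv_factorial_smul_add_pow,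
      LinearMap.sum_apply]
    rfl
  simp only [key] at h
  rw [sum_ite_eq' (range (N + 1)) 0 (fun _ => f)] at h
  exact hF.anti N.le_succ (by simpa using h)

/-- Solving `exp (T f) x₀ = w` for `f`, where `T f x₀ = f` and `T f` depends on `f` in a
degree-raising manner. -/
lemma exists_isExp_eq (hF : IsCompleteFiltration F) {C : Submodule ℝ E} (hC : IsClosedFor F C)
    (T : E → E →ₗ[ℝ] E) (s : ℕ) (x₀ w : E) (hx₀ : x₀ ∈ F s) (hx₀C : x₀ ∈ C) (hwC : w ∈ C)
    (hw : w - x₀ ∈ F (s + 1))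
    (hT₀ : ∀ f, T f x₀ = f)
    (hTC : ∀ f ∈ C, ∀ g ∈ C, T f g ∈ C)
    (hT : ∀ f ∈ F (s + 1), Raises F (T f))
    (hTsub : ∀ N k f g h, f - g ∈ F N → h ∈ F (k + s) → T f h - T g h ∈ F (N + k)) :
    ∃ f ∈ C, f ∈ F (s + 1) ∧ IsExp F (T f) x₀ w := by
  classical
  choose! e he using fun f (hf : f ∈ F (s + 1)) => exists_isExp hF (hT f hf) x₀
  have heC : ∀ f ∈ C, f ∈ F (s + 1) → e f ∈ C := fun f hf hf' =>
    (he f hf').mem_of_isClosedFor hC (hTC f hf) hx₀C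
  have hpow : ∀ f ∈ F (s + 1), ∀ g ∈ F (s + 1), ∀ N, f - g ∈ F N → ∀ k,
      ((T f) ^ (k + 1)) x₀ - ((T g) ^ (k + 1)) x₀ ∈ F (N + k) := by
    intro f hf g hg N hfg k
    induction k with
    | zero => simpa [hT₀] using hfg
    | succ k ih =>
      rw [pow_succ' _ (k + 1), pow_succ' _ (k + 1), Module.End.mul_apply, Module.End.mul_apply]
      have h₁ := hT f hf _ _ ih
      have h₂ := hTsub N (k + 1) f g _ hfg
        (by simpa [add_comm] using (hT g hg).pow_mem hx₀ (k + 1))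
      simpa [map_sub, add_assoc] using (F _).add_mem h₁ h₂
  -- The terms k = 0, 1 of the series are `x₀` and `f`. Hence `f - e f` involves, apart from `x₀`,
  -- only terms with k ≥ 2, whose dependence on `f` gains a degree.
  have hcontr : ∀ f ∈ F (s + 1), ∀ g ∈ F (s + 1), ∀ N, f - g ∈ F N →
      (f - e f) - (g - e g) ∈ F (N + 1) := by
    intro f hf g hg N hfg
    have h₁ := (F _).sub_mem (hF.anti (by omega : N + 1 ≤ N + 2) (he g hg (N + 2)))
      (hF.anti (by omega : N + 1 ≤ N + 2) (he f hf (N + 2)))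
    have h₂ : expSum (T f) x₀ (N + 2) - expSum (T g) x₀ (N + 2) - (f - g) ∈ F (N + 1) := by
      have : expSum (T f) x₀ (N + 2) - expSum (T g) x₀ (N + 2) - (f - g) =
          ∑ k ∈ range N, (((k + 2).factorial : ℝ)⁻¹) •
            (((T f) ^ (k + 1 + 1)) x₀ - ((T g) ^ (k + 1 + 1)) x₀) := by
        simp only [expSum, smul_sub, sum_sub_distrib, sum_range_succ' _ (N + 1),
          sum_range_succ' _ N]
        simp [hT₀]
        abel
      rw [this]
      exact (F _).sum_mem fun k _ => (F _).smul_mem _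
        (hF.anti (by omega) (hpow f hf g hg N hfg (k + 1)))
    have := (F _).sub_mem h₁ h₂
    convert this using 1
    abel
  have he₁ : ∀ f ∈ F (s + 1), e f - x₀ ∈ F (s + 1) := by
    intro f hf
    have h := he f hf (s + 1)
    rw [expSum, sum_range_succ'] at h
    have h' : ∑ k ∈ range s, (((k + 1).factorial : ℝ)⁻¹) • (T f ^ (k + 1)) x₀ ∈ F (s + 1) :=
      (F _).sum_mem fun k _ => (F _).smul_mem _
        (hF.anti (by omega) ((hT f hf).pow_mem hx₀ (k + 1)))
    have := (F _).add_mem h h'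
    rw [← sub_sub, sub_right_comm, sub_add_cancel] at this
    simpa using this
  -- A fixed point of `P` solves `e f = w`. By `hcontr` the map `P` is a contraction for the
  -- filtration, so its iterates from 0 converge.
  let P : E → E := fun f => f + w - e f
  have hPF : ∀ f ∈ F (s + 1), P f ∈ F (s + 1) := fun f hf => by
    have := (F _).add_mem hf ((F _).sub_mem hw (he₁ f hf))
    convert this using 1
    simp only [P]; abel
  have hPC : ∀ f ∈ C, f ∈ F (s + 1) → P f ∈ C := fun f hf hf' =>
    C.sub_mem (C.add_mem hf hwC) (heC f hf hf')
  let q : ℕ → E := fun N => P^[N] 0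
  have hq : ∀ N, q (N + 1) = P (q N) := fun N => Function.iterate_succ_apply' P N 0
  have hqF : ∀ N, q N ∈ F (s + 1) := fun N => by
    induction N with
    | zero => exact (F _).zero_mem
    | succ N ih => rw [hq]; exact hPF _ ih
  have hqC : ∀ N, q N ∈ C := fun N => by
    induction N with
    | zero => exact C.zero_mem
    | succ N ih => rw [hq]; exact hPC _ ih (hqF N)
  have hPsub : ∀ f ∈ F (s + 1), ∀ g ∈ F (s + 1), ∀ N, f - g ∈ F N → P f - P g ∈ F (N + 1) :=
    fun f hf g hg N h => by
      convert hcontr f hf g hg N h using 1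
      simp only [P]; abel
  have hstep : ∀ N, q (N + 1) - q N ∈ F N := fun N => by
    induction N with
    | zero => simp [hF.zero]
    | succ N ih =>
      have := hPsub _ (hqF (N + 1)) _ (hqF N) N ih
      rwa [← hq, ← hq] at this
  obtain ⟨l, hl⟩ := hF.complete q hstep
  have hlF : l ∈ F (s + 1) := by
    simpa using (F _).add_mem (hl (s + 1)) (hqF (s + 1))
  have hlC : l ∈ C := hC l fun N => ⟨q N, hqC N, hl N⟩
  have hPl : P l = l := hF.eq_of_sub_mem fun N => by
    have h₁ := hPsub l hlF _ (hqF N) N (hl N)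
    rw [← hq] at h₁
    have h₂ := (F _).sub_mem h₁ (hl (N + 1))
    exact hF.anti N.le_succ (by simpa using h₂)
  refine ⟨l, hlC, hlF, ?_⟩
  have : e l = w := by
    have : l + w = l + e l := sub_eq_iff_eq_add.1 hPl
    exact (add_left_cancel this).symm
  exact this ▸ he l hlF

end Filtration

open MvPowerSeries (coeff)

/-! ### Power series filtered by order; the feed-forward rings -/

section Series

variable {n : ℕ}

/-- Power series all of whose terms have degree at least `N`. -/
def orderGE (n N : ℕ) : Submodule ℝ (Series n) where
  carrier := {f | ∀ d, d.degree < N → coeff d f = 0}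
  add_mem' hf hg d hd := by rw [map_add, hf d hd, hg d hd, add_zero]
  zero_mem' _ _ := by simp
  smul_mem' c f hf d hd := by rw [MvPowerSeries.coeff_smul, hf d hd, mul_zero]

/-- Formal vector fields all of whose terms have degree at least `N`. -/
def orderGEVec (n N : ℕ) : Submodule ℝ (Fin n → Series n) :=
  Submodule.pi Set.univ fun _ => orderGE n N

lemma mem_orderGEVec {N : ℕ} {V : Fin n → Series n} :
    V ∈ orderGEVec n N ↔ ∀ i, V i ∈ orderGE n N := by
  simp [orderGEVec]

lemma mem_orderGE_iff_le_order {N : ℕ} {f : Series n} : f ∈ orderGE n N ↔ (N : ℕ∞) ≤ f.order := by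
  refine ⟨fun h => MvPowerSeries.nat_le_order h, fun h d hd => ?_⟩
  exact MvPowerSeries.coeff_of_lt_order (lt_of_lt_of_le (by exact_mod_cast hd) h)

lemma mem_orderGE_zero (f : Series n) : f ∈ orderGE n 0 := fun _ hd => absurd hd (Nat.not_lt_zero _)

lemma orderGE_anti : Antitone (orderGE n) := fun _ _ h _ hf d hd => hf d (hd.trans_le h)

lemma mul_mem_orderGE {M N : ℕ} {f g : Series n} (hf : f ∈ orderGE n M) (hg : g ∈ orderGE n N) :
    f * g ∈ orderGE n (M + N) := by
  rw [mem_orderGE_iff_le_order] at *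
  push_cast
  exact (add_le_add hf hg).trans MvPowerSeries.le_order_mul

lemma mul_mem_orderGE_right {N : ℕ} (f : Series n) {g : Series n} (hg : g ∈ orderGE n N) :
    f * g ∈ orderGE n N := by
  simpa using mul_mem_orderGE (mem_orderGE_zero f) hg

lemma pow_mem_orderGE {N : ℕ} {f : Series n} (hf : f ∈ orderGE n N) (k : ℕ) :
    f ^ k ∈ orderGE n (k * N) := by
  induction k with
  | zero => simpa using mem_orderGE_zero _
  | succ k ih => rw [pow_succ, add_mul, one_mul]; exact mul_mem_orderGE ih hf

lemma pderiv_mem_orderGE {N : ℕ} {f : Series n} (hf : f ∈ orderGE n (N + 1)) (i : Fin n) :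
    MvPowerSeries.pderiv ℝ i f ∈ orderGE n N := fun d hd => by
  rw [MvPowerSeries.coeff_pderiv, hf _ (by simpa using hd), zero_mul]

lemma X_mem_orderGE (i : Fin n) : (MvPowerSeries.X i : Series n) ∈ orderGE n 1 := fun d hd => by
  classical
  rw [MvPowerSeries.coeff_X, if_neg]
  rintro rfl
  simp at hd

lemma mem_orderGE_one {f : Series n} :
    f ∈ orderGE n 1 ↔ MvPowerSeries.constantCoeff f = 0 := by
  refine ⟨fun h => ?_, fun h d hd => ?_⟩
  · rw [← MvPowerSeries.coeff_zero_eq_constantCoeff_apply]; exact h 0 (by simp)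
  · obtain rfl : d = 0 := (Finsupp.degree_eq_zero_iff d).1 (Nat.lt_one_iff.1 hd)
    rwa [MvPowerSeries.coeff_zero_eq_constantCoeff_apply]

lemma isCompleteFiltration_orderGE : IsCompleteFiltration (orderGE n) where
  anti := orderGE_anti
  zero := eq_top_iff.2 fun f _ => mem_orderGE_zero f
  separated f hf := MvPowerSeries.ext fun d => hf (d.degree + 1) d (Nat.lt_succ_self _)
  complete s hs := by
    have hs' : ∀ N k, s (N + k) - s N ∈ orderGE n N := fun N k => by
      induction k with
      | zero => simp
      | succ k ih =>
        have := (orderGE n N).add_mem (orderGE_anti (Nat.le_add_right N k) (hs (N + k))) ih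
        simpa [add_assoc] using this
    -- From index `d.degree + 1` on, the coefficient at `d` no longer changes.
    let l : Series n := fun d => coeff d (s (d.degree + 1))
    refine ⟨l, fun N d hd => ?_⟩
    rw [map_sub, sub_eq_zero]
    obtain ⟨k, rfl⟩ := Nat.exists_eq_add_of_le (Nat.succ_le_of_lt hd)
    have := hs' (d.degree + 1) k d (Nat.lt_succ_self _)
    rw [map_sub, sub_eq_zero] at this
    exact this.symm

lemma isCompleteFiltration_orderGEVec : IsCompleteFiltration (orderGEVec n) where
  anti _ _ h _ hV := mem_orderGEVec.2 fun i => orderGE_anti h (mem_orderGEVec.1 hV i)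
  zero := eq_top_iff.2 fun V _ => mem_orderGEVec.2 fun i => mem_orderGE_zero (V i)
  separated V hV := funext fun i =>
    isCompleteFiltration_orderGE.separated _ fun N => mem_orderGEVec.1 (hV N) i
  complete s hs := by
    choose l hl using fun i => isCompleteFiltration_orderGE.complete (fun N => s N i)
      fun N => mem_orderGEVec.1 (hs N) i
    exact ⟨l, fun N => mem_orderGEVec.2 fun i => hl i N⟩

/-- The ring `ℝ[[xᵢ, …, xₙ]]` as a subalgebra. -/
def ringFromAlg (i : Fin n) : Subalgebra ℝ (Series n) where
  carrier := ringFrom i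
  mul_mem' {f g} hf hg d hd j hj := by
    classical
    rw [MvPowerSeries.coeff_mul] at hd
    obtain ⟨p, hp, hne⟩ := exists_ne_zero_of_sum_ne_zero hd
    rw [← HasAntidiagonal.mem_antidiagonal.1 hp, Finsupp.add_apply,
      hf _ (left_ne_zero_of_mul hne) j hj, hg _ (right_ne_zero_of_mul hne) j hj]
  add_mem' {f g} hf hg d hd j hj := by
    by_cases h : coeff d f = 0
    · exact hg d (by simpa [h] using hd) j hj
    · exact hf d h j hj
  algebraMap_mem' c d hd j hj := by
    classical
    rw [MvPowerSeries.algebraMap_apply, Algebra.algebraMap_self_apply, MvPowerSeries.coeff_C] at hd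
    have : d = 0 := by by_contra h; simp [h] at hd
    simp [this]

lemma isClosedFor_ringFromAlg (i : Fin n) :
    IsClosedFor (orderGE n) (Subalgebra.toSubmodule (ringFromAlg i)) := fun l hl d hd j hj => by
  obtain ⟨c, hc, hlc⟩ := hl (d.degree + 1)
  have := hlc d (Nat.lt_succ_self _)
  rw [map_sub, sub_eq_zero] at this
  exact hc d (this ▸ hd) j hj

lemma ringFromAlg_anti {i j : Fin n} (h : i ≤ j) : ringFromAlg j ≤ ringFromAlg i :=
  fun _ hf d hd k hk => hf d hd k (hk.trans_le h)

lemma X_mem_ringFromAlg (i : Fin n) : (MvPowerSeries.X i : Series n) ∈ ringFromAlg i :=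
  fun d hd j hj => by
    classical
    rw [MvPowerSeries.coeff_X] at hd
    have : d = Finsupp.single i 1 := by by_contra h; simp [h] at hd
    rw [this, Finsupp.single_eq_of_ne hj.ne]

lemma pderiv_mem_ringFromAlg {i : Fin n} {f : Series n} (hf : f ∈ ringFromAlg i) (j : Fin n) :
    MvPowerSeries.pderiv ℝ j f ∈ ringFromAlg i := fun d hd k hk => by
  rw [MvPowerSeries.coeff_pderiv] at hd
  have := hf _ (left_ne_zero_of_mul hd) k hk
  simp only [Finsupp.add_apply] at this
  omega

lemma pderiv_eq_zero_of_lt {i j : Fin n} {f : Series n} (hf : f ∈ ringFromAlg i) (h : j < i) :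
    MvPowerSeries.pderiv ℝ j f = 0 := MvPowerSeries.ext fun d => by
  rw [MvPowerSeries.coeff_pderiv, map_zero]
  by_contra hd
  have := hf _ (left_ne_zero_of_mul hd) j h
  simp at this

/-- The feed-forward vector fields as a subspace. -/
def fieldsSub (n : ℕ) : Submodule ℝ (Fin n → Series n) :=
  Submodule.pi Set.univ fun i => Subalgebra.toSubmodule (ringFromAlg i)

lemma mem_fieldsSub {V : Fin n → Series n} : V ∈ fieldsSub n ↔ ∀ i, V i ∈ ringFromAlg i := by
  simp [fieldsSub]

lemma mem_fieldsSub_iff_mem_fields {V : Fin n → Series n} : V ∈ fieldsSub n ↔ V ∈ fields n :=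
  mem_fieldsSub

lemma isClosedFor_fieldsSub : IsClosedFor (orderGEVec n) (fieldsSub n) := fun l hl =>
  mem_fieldsSub.2 fun i => isClosedFor_ringFromAlg i _ fun N => by
    obtain ⟨c, hc, hlc⟩ := hl N
    exact ⟨c i, mem_fieldsSub.1 hc i, mem_orderGEVec.1 hlc i⟩

/-! ### Vector fields as derivations, and the operator ρ(r, X) -/

/-- The derivation of the ring of formal power series given by a vector field. -/
def alongDer (V : Fin n → Series n) : Derivation ℝ (Series n) (Series n) :=
  Derivation.mk' (∑ j, V j • (MvPowerSeries.pderiv ℝ j : Series n →ₗ[ℝ] Series n)) fun f g => by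
    simp only [LinearMap.sum_apply, LinearMap.smul_apply, Derivation.coeFn_coe,
      Derivation.leibniz, smul_eq_mul, mul_sum, ← sum_add_distrib]
    exact sum_congr rfl fun j _ => by ring

lemma alongDer_apply (V : Fin n → Series n) (f : Series n) : alongDer V f = along V f := by
  simp [alongDer, along]

/-- A vector field as a linear operator on power series. -/
def alongLin : (Fin n → Series n) →ₗ[ℝ] Module.End ℝ (Series n) where
  toFun V := (alongDer V : Series n →ₗ[ℝ] Series n)
  map_add' V W := LinearMap.ext fun f => by
    simp [alongDer_apply, along, add_mul, sum_add_distrib]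
  map_smul' c V := LinearMap.ext fun f => by
    simp [alongDer_apply, along, smul_sum]

lemma alongLin_apply (V : Fin n → Series n) (f : Series n) : alongLin V f = along V f :=
  alongDer_apply V f

lemma along_mul (V : Fin n → Series n) (f g : Series n) :
    along V (f * g) = f * along V g + g * along V f := by
  simp only [← alongDer_apply, Derivation.leibniz, smul_eq_mul]

lemma along_X (V : Fin n → Series n) (i : Fin n) : along V (MvPowerSeries.X i) = V i := by
  classical
  simp [along, MvPowerSeries.pderiv_X, Pi.single_apply]

lemma along_mem_orderGE {M N : ℕ} {V : Fin n → Series n} (hV : V ∈ orderGEVec n M)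
    {f : Series n} (hf : f ∈ orderGE n (N + 1)) : along V f ∈ orderGE n (M + N) :=
  (orderGE n _).sum_mem fun j _ => mul_mem_orderGE (mem_orderGEVec.1 hV j) (pderiv_mem_orderGE hf j)

lemma raises_alongLin {X : Fin n → Series n} (hX : X ∈ orderGEVec n 2) :
    Raises (orderGE n) (alongLin X) := fun N f hf => by
  rw [alongLin_apply]
  rcases N with _ | N
  · refine (orderGE n _).sum_mem fun j _ => ?_
    rw [mul_comm]
    exact mul_mem_orderGE_right _ (orderGE_anti one_le_two (mem_orderGEVec.1 hX j))
  · have := along_mem_orderGE hX hf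
    rwa [add_comm 2 N] at this

lemma along_mem_ringFromAlg {X : Fin n → Series n} (hX : X ∈ fieldsSub n) {i : Fin n}
    {f : Series n} (hf : f ∈ ringFromAlg i) : along X f ∈ ringFromAlg i :=
  (ringFromAlg i).sum_mem fun j _ => by
    rcases lt_or_ge j i with h | h
    · rw [pderiv_eq_zero_of_lt hf h, mul_zero]; exact (ringFromAlg i).zero_mem
    · exact (ringFromAlg i).mul_mem (ringFromAlg_anti h (mem_fieldsSub.1 hX j))
        (pderiv_mem_ringFromAlg hf j)

lemma pderiv_comm (i j : Fin n) (f : Series n) :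
    MvPowerSeries.pderiv ℝ i (MvPowerSeries.pderiv ℝ j f) =
      MvPowerSeries.pderiv ℝ j (MvPowerSeries.pderiv ℝ i f) := by
  rcases eq_or_ne i j with rfl | h
  · rfl
  ext d
  simp only [MvPowerSeries.coeff_pderiv, Finsupp.add_apply, Finsupp.single_eq_of_ne h,
    Finsupp.single_eq_of_ne h.symm, add_right_comm d (Finsupp.single i 1)]
  push_cast
  ring

/-- The second-order terms of the two compositions agree because partial derivatives commute, and so
cancel in the commutator. -/
lemma along_bracket (X Y : Fin n → Series n) (f : Series n) :
    along (bracket X Y) f = along X (along Y f) - along Y (along X f) := by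
  have h : ∀ X Y : Fin n → Series n, along X (along Y f) =
      ∑ j, along X (Y j) * MvPowerSeries.pderiv ℝ j f +
      ∑ j, ∑ k, Y j * X k * MvPowerSeries.pderiv ℝ k (MvPowerSeries.pderiv ℝ j f) := by
    intro X Y
    rw [← alongDer_apply, along, map_sum, ← sum_add_distrib]
    refine sum_congr rfl fun j _ => ?_
    rw [alongDer_apply, along_mul, add_comm, mul_comm]
    congr 1
    simp only [along, mul_sum, mul_assoc]
  have h' : ∑ j, ∑ k, X j * Y k * MvPowerSeries.pderiv ℝ k (MvPowerSeries.pderiv ℝ j f) =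
      ∑ j, ∑ k, Y j * X k * MvPowerSeries.pderiv ℝ k (MvPowerSeries.pderiv ℝ j f) := by
    rw [sum_comm]
    refine sum_congr rfl fun j _ => sum_congr rfl fun k _ => ?_
    rw [pderiv_comm, mul_comm (X k)]
  rw [h X Y, h Y X, h', add_sub_add_right_eq_sub, ← sum_sub_distrib]
  exact sum_congr rfl fun j _ => sub_mul _ _ _

/-- The operator `ρ(r, X)` as a linear map. -/
def rhoLin (r X : Fin n → Series n) : Module.End ℝ (Fin n → Series n) where
  toFun := rho r X
  map_add' Y Z := funext fun i => by
    have h₁ := congrArg (fun T => T (X i)) (map_add (alongLin (n := n)) Y Z)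
    have h₂ := map_add (alongLin X) (Y i) (Z i)
    simp only [LinearMap.add_apply, alongLin_apply] at h₁ h₂
    simp only [rho, bracket, Pi.add_apply, h₁, h₂]
    ring
  map_smul' c Y := funext fun i => by
    have h₁ := congrArg (fun T => T (X i)) (map_smul (alongLin (n := n)) c Y)
    have h₂ := map_smul (alongLin X) c (Y i)
    simp only [LinearMap.smul_apply, alongLin_apply] at h₁ h₂
    simp only [rho, bracket, Pi.smul_apply, h₁, h₂, RingHom.id_apply, mul_smul_comm, smul_add,
      smul_sub]

lemma rhoLin_apply (r X Y : Fin n → Series n) : rhoLin r X Y = rho r X Y := rfl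

lemma rhoLin_neg (r X : Fin n → Series n) : rhoLin (-r) (-X) = -rhoLin r X :=
  LinearMap.ext fun Y => funext fun i => by
    have h₁ := congrArg (fun T => T (Y i)) (map_neg (alongLin (n := n)) X)
    have h₂ := map_neg (alongLin Y) (X i)
    simp only [LinearMap.neg_apply, alongLin_apply] at h₁ h₂
    simp only [rhoLin_apply, LinearMap.neg_apply, rho, bracket, Pi.neg_apply, h₁, h₂]
    ring

lemma raises_rhoLin {r X : Fin n → Series n} (hr : r ∈ orderGEVec n 1) (hX : X ∈ orderGEVec n 2) :
    Raises (orderGEVec n) (rhoLin r X) := fun N Y hY => mem_orderGEVec.2 fun i => by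
  have hY' := mem_orderGEVec.1 hY i
  refine (orderGE n _).add_mem ?_ ((orderGE n _).sub_mem ?_ ?_)
  · rw [add_comm N]; exact mul_mem_orderGE (mem_orderGEVec.1 hr i) hY'
  · rw [← alongLin_apply]; exact raises_alongLin hX _ _ hY'
  · exact along_mem_orderGE hY (mem_orderGEVec.1 hX i)

/-- Links the coefficientwise sum defining `expRho` with the abstract exponential: the k-th term has
order at least k, so only k < N matter below degree N. -/
lemma isExp_expRho {r X : Fin n → Series n} (hr : r ∈ orderGEVec n 1) (hX : X ∈ orderGEVec n 2)
    (V : Fin n → Series n) : IsExp (orderGEVec n) (rhoLin r X) V (expRho r X V) := fun N =>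
  mem_orderGEVec.2 fun i d hd => by
    have hcoe : ∀ k, ((rhoLin r X) ^ k) V = (rho r X)^[k] V := fun k => Module.End.pow_apply _ _ _
    have h : coeff d (expRho r X V i) =
        ∑ k ∈ range N, ((k.factorial : ℝ)⁻¹) * coeff d (((rho r X)^[k] V) i) := by
      refine finsum_eq_sum_of_support_subset _ fun k hk => ?_
      by_contra hkN
      have hkN' : N ≤ k := by simpa using hkN
      have := mem_orderGEVec.1 ((raises_rhoLin hr hX).pow_mem_self
        isCompleteFiltration_orderGEVec V k) i d (hd.trans_le hkN')
      rw [hcoe] at this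
      exact hk (by simp [this])
    rw [Pi.sub_apply, map_sub, h, expSum, Finset.sum_apply, map_sum, sub_eq_zero]
    refine sum_congr rfl fun k _ => ?_
    rw [hcoe, Pi.smul_apply, MvPowerSeries.coeff_smul]

lemma rho_mem_fieldsSub {r X Y : Fin n → Series n} (hr : r ∈ fieldsSub n) (hX : X ∈ fieldsSub n)
    (hY : Y ∈ fieldsSub n) : rho r X Y ∈ fieldsSub n := mem_fieldsSub.2 fun i => by
  have hX' := mem_fieldsSub.1 hX i
  have hY' := mem_fieldsSub.1 hY i
  exact (ringFromAlg i).add_mem ((ringFromAlg i).mul_mem (mem_fieldsSub.1 hr i) hY')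
    ((ringFromAlg i).sub_mem (along_mem_ringFromAlg hX hY') (along_mem_ringFromAlg hY hX'))

/-- `exp ρ(r, X)` is a bijection of the space of feed-forward vector fields. -/
lemma bijOn_expRho {r X : Fin n → Series n} (hr : r ∈ orderGEVec n 1) (hX : X ∈ orderGEVec n 2)
    (hr' : r ∈ fieldsSub n) (hX' : X ∈ fieldsSub n) :
    Set.BijOn (expRho r X) (fields n) (fields n) := by
  have hmaps : ∀ {r X : Fin n → Series n}, r ∈ orderGEVec n 1 → X ∈ orderGEVec n 2 →
      r ∈ fieldsSub n → X ∈ fieldsSub n → Set.MapsTo (expRho r X) (fields n) (fields n) :=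
    fun hr hX hr' hX' V hV => mem_fieldsSub_iff_mem_fields.1 <|
      (isExp_expRho hr hX V).mem_of_isClosedFor isClosedFor_fieldsSub
      (fun Y hY => rho_mem_fieldsSub hr' hX' hY) (mem_fieldsSub_iff_mem_fields.2 hV)
  have hinv : ∀ {r X : Fin n → Series n}, r ∈ orderGEVec n 1 → X ∈ orderGEVec n 2 →
      ∀ V, expRho (-r) (-X) (expRho r X V) = V := fun {r X} hr hX V => by
    have h := (isExp_expRho hr hX V).neg_comp isCompleteFiltration_orderGEVec (raises_rhoLin hr hX)
    have h' := isExp_expRho ((orderGEVec n 1).neg_mem hr) ((orderGEVec n 2).neg_mem hX)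
      (expRho r X V)
    rw [rhoLin_neg] at h'
    exact h'.unique isCompleteFiltration_orderGEVec h
  have hrn := (orderGEVec n 1).neg_mem hr
  have hXn := (orderGEVec n 2).neg_mem hX
  refine Set.InvOn.bijOn (f' := expRho (-r) (-X)) ⟨fun V _ => hinv hr hX V, fun V _ => ?_⟩
    (hmaps hr hX hr' hX') (hmaps hrn hXn ((fieldsSub n).neg_mem hr') ((fieldsSub n).neg_mem hX'))
  simpa using hinv hrn hXn V

/-! ### Exponentials of vector fields as substitutions and as conjugations -/

open scoped TensorProduct in
/-- The Leibniz rule for divided powers of a derivation. -/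
lemma inv_factorial_smul_alongLin_pow_mul (X : Fin n → Series n) (f g : Series n) (k : ℕ) :
    ((k.factorial : ℝ)⁻¹) • (alongLin X ^ k) (f * g) = ∑ p ∈ antidiagonal k,
      (((p.1.factorial : ℝ)⁻¹) * ((p.2.factorial : ℝ)⁻¹)) •
        ((alongLin X ^ p.1) f * (alongLin X ^ p.2) g) := by
  -- On the tensor square the derivation becomes `L + R` with commuting summands, and multiplication
  -- `μ` intertwines it with `A`. The Leibniz rule is thus the binomial theorem.
  let A : Module.End ℝ (Series n) := alongLin X
  let L : Module.End ℝ (Series n ⊗[ℝ] Series n) := A.rTensor (Series n)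
  let R : Module.End ℝ (Series n ⊗[ℝ] Series n) := A.lTensor (Series n)
  have hLR : Commute L R := by
    change L ∘ₗ R = R ∘ₗ L
    simp only [L, R, LinearMap.rTensor_comp_lTensor, LinearMap.lTensor_comp_rTensor]
  let μ := LinearMap.mul' ℝ (Series n)
  have hμ : ∀ t, μ ((L + R) t) = A (μ t) := by
    intro t
    induction t with
    | zero => simp
    | tmul f g =>
      simp only [L, R, μ, LinearMap.add_apply, LinearMap.rTensor_tmul, LinearMap.lTensor_tmul,
        map_add, LinearMap.mul'_apply, A, alongLin_apply, along_mul]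
      ring
    | add s t hs ht => simp only [map_add, hs, ht]
  have hμk : ∀ k t, μ (((L + R) ^ k) t) = (A ^ k) (μ t) := by
    intro k
    induction k with
    | zero => simp
    | succ k ih => intro t; simp only [pow_succ', Module.End.mul_apply, hμ, ih]
  have h := congrArg (fun T : Module.End ℝ (Series n ⊗[ℝ] Series n) => μ (T (f ⊗ₜ g)))
    (Commute.inv_factorial_smul_add_pow (A := Module.End ℝ (Series n ⊗[ℝ] Series n)) hLR k)
  simp only [LinearMap.smul_apply, map_smul, hμk, LinearMap.sum_apply, map_sum] at h
  rw [show f * g = μ (f ⊗ₜ g) from rfl, h]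
  refine sum_congr rfl fun p _ => ?_
  simp only [L, R, Module.End.mul_apply, LinearMap.rTensor_pow, LinearMap.lTensor_pow]
  rfl

/-- The Leibniz rule for divided powers identifies the series of a product with the Cauchy product
of the two series; hence the exponential of a derivation is multiplicative. -/
lemma IsExp.mul {X : Fin n → Series n} (hX : X ∈ orderGEVec n 2) {f g e e' : Series n}
    (he : IsExp (orderGE n) (alongLin X) f e) (he' : IsExp (orderGE n) (alongLin X) g e') :
    IsExp (orderGE n) (alongLin X) (f * g) (e * e') := fun N => by
  have hT := raises_alongLin hX
  have hF := isCompleteFiltration_orderGE (n := n)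
  have h₁ := sum_sum_sub_sum_antidiagonal_mem hF
    (fun j l => (((j.factorial : ℝ)⁻¹) * ((l.factorial : ℝ)⁻¹)) •
      ((alongLin X ^ j) f * (alongLin X ^ l) g))
    (fun j l => (orderGE n _).smul_mem _
      (mul_mem_orderGE (hT.pow_mem_self hF f j) (hT.pow_mem_self hF g l))) N
  have h₂ : ∑ j ∈ range N, ∑ l ∈ range N, (((j.factorial : ℝ)⁻¹) * ((l.factorial : ℝ)⁻¹)) •
      ((alongLin X ^ j) f * (alongLin X ^ l) g) =
      expSum (alongLin X) f N * expSum (alongLin X) g N := by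
    rw [expSum, expSum, sum_mul_sum]
    refine sum_congr rfl fun j _ => sum_congr rfl fun l _ => ?_
    rw [smul_mul_smul_comm]
  simp only [← inv_factorial_smul_alongLin_pow_mul, h₂] at h₁
  have h₃ := (orderGE n N).add_mem
    (mul_mem_orderGE_right e (he' N)) (mul_mem_orderGE_right (expSum (alongLin X) g N) (he N))
  have := (orderGE n N).add_mem h₃ h₁
  rw [expSum]
  convert this using 1
  ring

/-- The exponential of a vector field is substitution of its values at the coordinates. -/
lemma isExp_subst {X : Fin n → Series n} (hX : X ∈ orderGEVec n 2) {φ : Fin n → Series n}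
    (hφ : ∀ i, IsExp (orderGE n) (alongLin X) (MvPowerSeries.X i) (φ i)) (f : Series n) :
    IsExp (orderGE n) (alongLin X) f (MvPowerSeries.subst φ f) := by
  have hT := raises_alongLin hX
  have hF := isCompleteFiltration_orderGE (n := n)
  choose e he using fun f => exists_isExp hF hT f
  have hC : ∀ c : ℝ, IsExp (orderGE n) (alongLin X) (algebraMap ℝ (Series n) c)
      (algebraMap ℝ (Series n) c) := by
    intro c N
    rcases N with _ | N
    · exact mem_orderGE_zero _
    · have : ∀ k, (alongLin X ^ (k + 1)) (algebraMap ℝ (Series n) c) = 0 := fun k => by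
        rw [pow_succ, Module.End.mul_apply, alongLin_apply, ← alongDer_apply,
          Derivation.map_algebraMap, map_zero]
      rw [expSum, sum_range_succ']
      simp [this]
  -- The exponential is an algebra homomorphism that agrees with substitution on the coordinates,
  -- hence on polynomials. Both preserve the order, so truncation extends the agreement to all
  -- series.
  let ε : Series n →ₐ[ℝ] Series n :=
    { toFun := e
      map_one' := (he 1).unique hF (by simpa using hC 1)
      map_mul' := fun f g => (he _).unique hF ((he f).mul hX (he g))
      map_zero' := (he 0).unique hF (by simpa using hC 0)
      map_add' := fun f g => (he _).unique hF ((he f).add (he g))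
      commutes' := fun c => (he _).unique hF (hC c) }
  have hφ₁ : ∀ i, φ i ∈ orderGE n 1 := fun i => (hφ i).mem hF hT (X_mem_orderGE i)
  have hsub : MvPowerSeries.HasSubst φ :=
    MvPowerSeries.hasSubst_of_constantCoeff_zero fun i => mem_orderGE_one.1 (hφ₁ i)
  have hpoly : ∀ p : MvPolynomial (Fin n) ℝ,
      MvPowerSeries.subst φ (p : Series n) = e (p : Series n) := by
    have : (MvPowerSeries.substAlgHom (R := ℝ) hsub).comp
        (MvPolynomial.coeToMvPowerSeries.algHom ℝ) =
        ε.comp (MvPolynomial.coeToMvPowerSeries.algHom ℝ) := by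
      refine MvPolynomial.algHom_ext fun i => ?_
      simp only [AlgHom.comp_apply, MvPolynomial.coeToMvPowerSeries.algHom_apply,
        MvPolynomial.coe_X, Algebra.algebraMap_self, MvPowerSeries.map_id, RingHom.id_apply,
        MvPowerSeries.substAlgHom_X]
      exact (hφ i).unique hF (he _)
    intro p
    have h := DFunLike.congr_fun this p
    simp only [AlgHom.comp_apply, MvPolynomial.coeToMvPowerSeries.algHom_apply,
      Algebra.algebraMap_self, MvPowerSeries.map_id, RingHom.id_apply,
      MvPowerSeries.substAlgHom_apply] at h
    exact h
  suffices MvPowerSeries.subst φ f = e f from this ▸ he f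
  refine hF.eq_of_sub_mem fun N => ?_
  have hrem : f - (f.truncTotal N : Series n) ∈ orderGE n N := fun d hd => by
    rw [map_sub, MvPolynomial.coeff_coe, MvPowerSeries.coeff_truncTotal _ hd, sub_self]
  have h₁ : MvPowerSeries.subst φ (f - (f.truncTotal N : Series n)) ∈ orderGE n N := by
    rw [mem_orderGE_iff_le_order] at hrem ⊢
    refine hrem.trans (le_trans ?_ (MvPowerSeries.le_order_subst hsub _))
    refine le_mul_of_one_le_left zero_le (le_iInf fun i => ?_)
    exact_mod_cast mem_orderGE_iff_le_order.1 (hφ₁ i)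
  have h₂ : ε (f - (f.truncTotal N : Series n)) ∈ orderGE n N := (he _).mem hF hT hrem
  rw [MvPowerSeries.subst_sub hsub, hpoly] at h₁
  rw [map_sub] at h₂
  have := (orderGE n N).sub_mem h₁ h₂
  rwa [show ε (f.truncTotal N : Series n) = e _ from rfl, sub_sub_sub_cancel_right] at this

/-- Iterated brackets with `X`, as operators on power series. -/
lemma inv_factorial_smul_alongLin_rhoLin_pow (X V : Fin n → Series n) (k : ℕ) :
    ((k.factorial : ℝ)⁻¹) • alongLin ((rhoLin 0 X ^ k) V) = ∑ p ∈ antidiagonal k,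
      (((p.1.factorial : ℝ)⁻¹) * ((p.2.factorial : ℝ)⁻¹)) •
        (alongLin X ^ p.1 * (alongLin V * (-alongLin X) ^ p.2)) := by
  let A : Module.End ℝ (Series n) := alongLin X
  -- On operators, ad X is left multiplication by `A` plus right multiplication by `-A`. These
  -- commute, so the binomial theorem applies.
  have h₁ : ∀ Y, alongLin (rhoLin 0 X Y) =
      (LinearMap.mulLeft ℝ A + LinearMap.mulRight ℝ (-A)) (alongLin Y) := fun Y => by
    ext1 f
    have : rhoLin 0 X Y = bracket X Y := funext fun i => by simp [rhoLin_apply, rho]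
    rw [this, alongLin_apply, along_bracket]
    simp only [A, LinearMap.add_apply, LinearMap.mulLeft_apply, LinearMap.mulRight_apply,
      Module.End.mul_apply, LinearMap.neg_apply, map_neg, alongLin_apply, sub_eq_add_neg]
  have h₂ : alongLin ((rhoLin 0 X ^ k) V) =
      ((LinearMap.mulLeft ℝ A + LinearMap.mulRight ℝ (-A)) ^ k) (alongLin V) := by
    induction k with
    | zero => simp
    | succ k ih => rw [pow_succ', pow_succ', Module.End.mul_apply, Module.End.mul_apply, h₁, ih]
  have h₃ := congrArg (fun T : Module.End ℝ (Module.End ℝ (Series n)) => T (alongLin V))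
    (Commute.inv_factorial_smul_add_pow (A := Module.End ℝ (Module.End ℝ (Series n)))
      (LinearMap.commute_mulLeft_right A (-A)) k)
  rw [h₂, ← LinearMap.smul_apply]
  refine h₃.trans ?_
  rw [LinearMap.sum_apply]
  refine sum_congr rfl fun p _ => ?_
  rw [LinearMap.smul_apply, Module.End.mul_apply, LinearMap.pow_mulLeft, LinearMap.pow_mulRight]
  rfl

/-- `exp ρ(0, X)` is conjugation by the exponential of `X`. -/
lemma isExp_along_expRho {X : Fin n → Series n} (hX : X ∈ orderGEVec n 2) {i : Fin n}
    {f : Series n} (hf : IsExp (orderGE n) (-alongLin X) (MvPowerSeries.X i) f)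
    (V : Fin n → Series n) :
    IsExp (orderGE n) (alongLin X) (along V f) (expRho 0 X V i) := by
  have hT := raises_alongLin hX
  have hF := isCompleteFiltration_orderGE (n := n)
  obtain ⟨e, he⟩ := exists_isExp hF hT (along V f)
  suffices e = expRho 0 X V i from this ▸ he
  refine hF.eq_of_sub_mem fun N => ?_
  have hV : ∀ N, ∀ f ∈ orderGE n (N + 1), alongLin V f ∈ orderGE n N := fun N f hf => by
    simpa [alongLin_apply] using
      along_mem_orderGE (M := 0) (mem_orderGEVec.2 fun i => mem_orderGE_zero (V i)) hf
  have h₁ := IsExp.comp_sub_mem hF hT hV (fun l => hV l _ (by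
    simpa [add_comm] using hT.neg.pow_mem (X_mem_orderGE i) l)) hf
    (by rwa [alongLin_apply]) N
  have h₂ := mem_orderGEVec.1 (isExp_expRho (orderGEVec n 1).zero_mem hX V N) i
  have h₃ : expSum (rhoLin 0 X) V N i = ∑ k ∈ range N, ∑ p ∈ antidiagonal k,
      (((p.1.factorial : ℝ)⁻¹) * ((p.2.factorial : ℝ)⁻¹)) •
        (alongLin X ^ p.1) (alongLin V (((-alongLin X) ^ p.2) (MvPowerSeries.X i))) := by
    rw [expSum, Finset.sum_apply]
    refine sum_congr rfl fun k _ => ?_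
    have := congrArg (fun T => T (MvPowerSeries.X i)) (inv_factorial_smul_alongLin_rhoLin_pow X V k)
    simp only [LinearMap.smul_apply, LinearMap.sum_apply, Module.End.mul_apply] at this
    rw [← this, alongLin_apply, along_X]
    rfl
  rw [Pi.sub_apply, h₃] at h₂
  simpa using (orderGE n N).sub_mem h₁ h₂

/-! ### Logarithms of formal maps and of units -/

/-- Every near-identity feed-forward formal map is the exponential of a feed-forward vector
field. -/
lemma exists_isExp_X_eq {φ : Fin n → Series n} (hφ : φ ∈ maps n) :
    ∃ X ∈ fieldsSub n, X ∈ orderGEVec n 2 ∧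
      ∀ i, IsExp (orderGE n) (alongLin X) (MvPowerSeries.X i) (φ i) := by
  let T : (Fin n → Series n) → Module.End ℝ (Fin n → Series n) := fun X =>
    LinearMap.pi fun i => alongLin X ∘ₗ LinearMap.proj i
  have hTk : ∀ X k Y i, ((T X) ^ k) Y i = (alongLin X ^ k) (Y i) := fun X k => by
    induction k with
    | zero => simp
    | succ k ih =>
      intro Y i
      rw [pow_succ', pow_succ', Module.End.mul_apply, Module.End.mul_apply, ← ih]
      rfl
  -- The shift is 1, the order of the identity map: the generator then has order at least 2.
  obtain ⟨X, hX, hX₂, he⟩ := exists_isExp_eq isCompleteFiltration_orderGEVec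
    isClosedFor_fieldsSub T 1 (fun i => MvPowerSeries.X i) φ
    (mem_orderGEVec.2 X_mem_orderGE) (mem_fieldsSub.2 X_mem_ringFromAlg)
    (mem_fieldsSub.2 fun i => (hφ i).1)
    (mem_orderGEVec.2 fun i => mem_orderGE_iff_le_order.2 (hφ i).2)
    (fun X => funext fun i => (alongLin_apply X _).trans (along_X X i))
    (fun X hX Y hY => mem_fieldsSub.2 fun i => by
      simpa [T, alongLin_apply] using along_mem_ringFromAlg hX (mem_fieldsSub.1 hY i))
    (fun X hX N Y hY => mem_orderGEVec.2 fun i =>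
      raises_alongLin hX N _ (mem_orderGEVec.1 hY i))
    (fun N k X Y Z hXY hZ => mem_orderGEVec.2 fun i => by
      have := along_mem_orderGE hXY (mem_orderGEVec.1 hZ i)
      rwa [← alongLin_apply, map_sub] at this)
  refine ⟨X, hX, hX₂, fun i N => ?_⟩
  have := mem_orderGEVec.1 (he N) i
  have h : expSum (T X) (fun i => MvPowerSeries.X i) N i =
      expSum (alongLin X) (MvPowerSeries.X i) N := by
    simp only [expSum, Finset.sum_apply, Pi.smul_apply, hTk]
  rwa [Pi.sub_apply, h] at this

/-- Families of series with constant term one are exponentials. -/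
lemma exists_expRho_one_eq {w : Fin n → Series n} (hw : w ∈ fieldsSub n)
    (hw₁ : ∀ i, w i - 1 ∈ orderGE n 1) :
    ∃ r ∈ fieldsSub n, r ∈ orderGEVec n 1 ∧ ∀ V, expRho r 0 (w * V) = V := by
  have h0 : ∀ r Y i, rhoLin r (0 : Fin n → Series n) Y i = r i * Y i := fun r Y i => by
    simp [rhoLin_apply, rho, bracket, along]
  obtain ⟨r, hr, hr₁, he⟩ := exists_isExp_eq isCompleteFiltration_orderGEVec
    isClosedFor_fieldsSub (fun r => rhoLin r (0 : Fin n → Series n)) 0 1 w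
    (mem_orderGEVec.2 fun i => mem_orderGE_zero _) (mem_fieldsSub.2 fun i => one_mem _) hw
    (mem_orderGEVec.2 hw₁) (fun r => funext fun i => by simp [h0])
    (fun r hr Y hY => rho_mem_fieldsSub hr (fieldsSub n).zero_mem hY)
    (fun r hr => raises_rhoLin hr (orderGEVec n 2).zero_mem)
    (fun N k r r' Y hrr hY => mem_orderGEVec.2 fun i => by
      rw [Pi.sub_apply, h0, h0, ← sub_mul]
      exact mul_mem_orderGE (mem_orderGEVec.1 hrr i) (mem_orderGEVec.1 hY i))
  -- Since `w` is the exponential of `r`, multiplication by `w` is undone by the exponential of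
  -- `-r`.
  refine ⟨-r, (fieldsSub n).neg_mem hr, (orderGEVec n 1).neg_mem hr₁, fun V => ?_⟩
  have hpow : ∀ k Y i, ((rhoLin r (0 : Fin n → Series n)) ^ k) Y i = r i ^ k * Y i := fun k => by
    induction k with
    | zero => simp
    | succ k ih => intro Y i; rw [pow_succ', Module.End.mul_apply, h0, ih, pow_succ', mul_assoc]
  have he' : IsExp (orderGEVec n) (rhoLin r 0) V (w * V) := fun N => mem_orderGEVec.2 fun i => by
    have := mul_mem_orderGE_right (V i) (mem_orderGEVec.1 (he N) i)
    simp only [expSum, Pi.sub_apply, Finset.sum_apply, Pi.smul_apply, hpow, mul_sub, mul_sum,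
      Pi.one_apply, mul_one, mul_smul_comm] at this
    simpa only [expSum, Pi.sub_apply, Finset.sum_apply, Pi.smul_apply, hpow, Pi.mul_apply,
      mul_comm (V i)] using this
  have h := he'.neg_comp isCompleteFiltration_orderGEVec
    (raises_rhoLin hr₁ (orderGEVec n 2).zero_mem)
  rw [← rhoLin_neg, neg_zero] at h
  exact (isExp_expRho ((orderGEVec n 1).neg_mem hr₁) (orderGEVec n 2).zero_mem _).unique
    isCompleteFiltration_orderGEVec h

/-! ### Solving V(φ) = u (φ' + a φ²) degree by degree -/

lemma coeff_single_X_pow_mul (i : Fin n) (k m : ℕ) (f : Series n) :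
    coeff (Finsupp.single i (k + m)) (MvPowerSeries.X i ^ k * f) =
      coeff (Finsupp.single i m) f := by
  rw [MvPowerSeries.X_pow_eq, Finsupp.single_add, MvPowerSeries.coeff_add_monomial_mul, one_mul]

/-- The quotient of `f` by the variable `xⱼ`, dropping the terms not divisible by `xⱼ`. -/
def divX (j : Fin n) (f : Series n) : Series n := fun d => coeff (d + Finsupp.single j 1) f

lemma coeff_divX (j : Fin n) (f : Series n) (d : Fin n →₀ ℕ) :
    coeff d (divX j f) = coeff (d + Finsupp.single j 1) f := rfl

lemma coeff_sub_X_mul_divX (j : Fin n) (f : Series n) (d : Fin n →₀ ℕ) :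
    coeff d (f - MvPowerSeries.X j * divX j f) = if d j = 0 then coeff d f else 0 := by
  classical
  rw [map_sub, MvPowerSeries.X, MvPowerSeries.coeff_monomial_mul, one_mul, coeff_divX]
  simp only [Finsupp.single_le_iff]
  split_ifs with h₁ h₂ h₂
  · omega
  · rw [tsub_add_cancel_of_le (Finsupp.single_le_iff.2 h₁), sub_self]
  · exact sub_zero _
  · omega

lemma divX_mem_orderGE {j : Fin n} {f : Series n} {N : ℕ} (hf : f ∈ orderGE n (N + 1)) :
    divX j f ∈ orderGE n N := fun d hd => hf _ (by simpa using hd)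

lemma divX_mem_ringFromAlg {i j : Fin n} {f : Series n} (hf : f ∈ ringFromAlg i) :
    divX j f ∈ ringFromAlg i := fun d hd k hk => by
  have := hf _ hd k hk
  simp only [Finsupp.add_apply] at this
  omega

/-- The defect of `φ` and the unit `u` in the equation `V(φ) = u (φ' + a φ²)`. -/
def residual (V : Fin n → Series n) (φ' : Series n) (a : ℝ) (φ u : Series n) : Series n :=
  along V φ - u * (φ' + a • φ ^ 2)

lemma along_add (V : Fin n → Series n) (f g : Series n) :
    along V (f + g) = along V f + along V g := by
  simp only [← alongLin_apply, map_add]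

/-- An exact expansion, with no terms discarded, so that it serves both the correction steps and the
passage to the limit. -/
lemma residual_add (V : Fin n → Series n) (φ' : Series n) (a : ℝ) (φ u ψ v : Series n) :
    residual V φ' a (φ + ψ) (u + v) = residual V φ' a φ u +
      (along V ψ - v * (φ' + a • (φ + ψ) ^ 2)) - a • (u * (2 * φ * ψ + ψ ^ 2)) := by
  simp only [residual, along_add, MvPowerSeries.smul_eq_C_mul]
  ring

lemma along_mem_orderGE_self {V : Fin n → Series n} (hV : V ∈ orderGEVec n 1) {N : ℕ}
    {f : Series n} (hf : f ∈ orderGE n N) : along V f ∈ orderGE n N := by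
  rcases N with _ | N
  · exact mem_orderGE_zero _
  · rw [add_comm]; exact along_mem_orderGE hV hf

section Normalizing

variable {V : Fin n → Series n} {i : Fin n} {φ' : Series n} {a : ℝ}

/-- One step of normalization: removing the terms of lowest degree in the residual, up to
multiples of a power of `xᵢ`. -/
lemma residual_add_mem {y g B φ u : Series n} {N : ℕ} (hy : y ∈ orderGE n 1)
    (hφ' : φ' - y ∈ orderGE n 2) (hφ : φ ∈ orderGE n 1) (hg : g ∈ orderGE n (N + 1))
    (hB : B ∈ orderGE n (N + 1))
    (h : residual V φ' a φ u + along V (y * g) - y * B ∈ orderGE n (N + 3)) :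
    residual V φ' a (φ + y * g) (u + B) ∈ orderGE n (N + 3) := by
  have hyg : y * g ∈ orderGE n (N + 2) := by
    have := mul_mem_orderGE hy hg
    rwa [add_comm 1] at this
  have h₁ : B * (φ' - y + a • (φ + y * g) ^ 2) ∈ orderGE n (N + 3) := by
    refine mul_mem_orderGE (N := 2) hB ((orderGE n 2).add_mem hφ' ((orderGE n 2).smul_mem _ ?_))
    have hs : φ + y * g ∈ orderGE n 1 :=
      (orderGE n 1).add_mem hφ (orderGE_anti (by omega) hyg)
    exact pow_mem_orderGE hs 2
  have h₂ : a • (u * ((2 * φ + y * g) * (y * g))) ∈ orderGE n (N + 3) := by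
    refine (orderGE n _).smul_mem _ (mul_mem_orderGE_right _ ?_)
    have hs : 2 * φ + y * g ∈ orderGE n 1 :=
      (orderGE n 1).add_mem (mul_mem_orderGE_right _ hφ) (orderGE_anti (by omega) hyg)
    have := mul_mem_orderGE hs hyg
    rwa [add_comm 1] at this
  have := (orderGE n _).sub_mem ((orderGE n _).sub_mem h h₁) h₂
  rw [residual_add]
  convert this using 1
  simp only [MvPowerSeries.smul_eq_C_mul]
  ring

/-- One step of normalization: removing a multiple of a power of `xᵢ` from the residual. -/
lemma exists_residual_coeff_eq_zero {φ u : Series n} {M : ℕ}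
    (hVi : V i - φ' ∈ orderGE n 2) (hcoeff : coeff (Finsupp.single i 2) (V i - φ') = a)
    (ha : a ≠ 0) (hφ : φ - MvPowerSeries.X i ∈ orderGE n 2) (hu : u - 1 ∈ orderGE n 1)
    (h : residual V φ' a φ u ∈ orderGE n (M + 3)) :
    ∃ c c' : ℝ, residual V φ' a (φ + c • MvPowerSeries.X i ^ (M + 2))
        (u + c' • MvPowerSeries.X i ^ (M + 1)) ∈ orderGE n (M + 3) ∧
      coeff (Finsupp.single i (M + 3)) (residual V φ' a (φ + c • MvPowerSeries.X i ^ (M + 2))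
        (u + c' • MvPowerSeries.X i ^ (M + 1))) = 0 := by
  let x : Series n := MvPowerSeries.X i
  -- Adding c xᵢ^(M+2) to φ and c(M+2) xᵢ^(M+1) to u makes the contributions of φ' and of a xᵢ² to
  -- V(ψ) cancel on the pure power. What survives is −2ac xᵢ^(M+3), from the cross term of φ²; hence
  -- the divisor 2a.
  let c : ℝ := coeff (Finsupp.single i (M + 3)) (residual V φ' a φ u) / (2 * a)
  have hx : x ∈ orderGE n 1 := X_mem_orderGE i
  have hxk : ∀ k, x ^ k ∈ orderGE n k := fun k => by simpa using pow_mem_orderGE hx k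
  have hφ₁ : φ ∈ orderGE n 1 := by
    simpa using (orderGE n 1).add_mem (orderGE_anti one_le_two hφ) (X_mem_orderGE i)
  let ψ : Series n := c • x ^ (M + 2)
  have hψ : ψ ∈ orderGE n (M + 2) := (orderGE n _).smul_mem _ (hxk _)
  let Z : Series n := V i - φ' - a • (φ + ψ) ^ 2
  have hsq : (φ + ψ) ^ 2 - x ^ 2 ∈ orderGE n 3 := by
    have h₁ : φ + ψ - x ∈ orderGE n 2 := by
      rw [add_sub_right_comm]
      exact (orderGE n 2).add_mem hφ (orderGE_anti (by omega) hψ)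
    have h₂ : φ + ψ + x ∈ orderGE n 1 := (orderGE n 1).add_mem
      ((orderGE n 1).add_mem hφ₁ (orderGE_anti (by omega) hψ)) hx
    have := mul_mem_orderGE h₁ h₂
    convert this using 1
    ring
  have hcoeff_x : ∀ k, coeff (Finsupp.single i k) (x ^ k) = 1 := fun k => by
    classical simp [x, MvPowerSeries.coeff_X_pow]
  have hZ : Z ∈ orderGE n 2 := by
    refine (orderGE n 2).sub_mem hVi ((orderGE n 2).smul_mem _ ?_)
    simpa using (orderGE n 2).add_mem (orderGE_anti (by omega) hsq) (hxk 2)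
  have hZc : coeff (Finsupp.single i 2) Z = 0 := by
    have := hsq (Finsupp.single i 2) (by simp)
    rw [map_sub, hcoeff_x, sub_eq_zero] at this
    rw [map_sub, MvPowerSeries.coeff_smul, this, hcoeff, mul_one, sub_self]
  have hu' : u * φ - x ∈ orderGE n 2 := by
    have := (orderGE n 2).add_mem (mul_mem_orderGE hu hφ₁) hφ
    convert this using 1
    simp only [x]
    ring
  have hY : u * (2 * φ * ψ + ψ ^ 2) - (2 * c) • x ^ (M + 3) ∈ orderGE n (M + 4) := by
    have h₁ : (2 * c) • (x ^ (M + 2) * (u * φ - x)) ∈ orderGE n (M + 4) :=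
      (orderGE n _).smul_mem _ (mul_mem_orderGE (M := M + 2) (hxk _) hu')
    have h₂ : u * ψ ^ 2 ∈ orderGE n (M + 4) := mul_mem_orderGE_right _
      (orderGE_anti (by omega) (pow_mem_orderGE hψ 2))
    have := (orderGE n _).add_mem h₁ h₂
    convert this using 1
    simp only [ψ, MvPowerSeries.smul_eq_C_mul, map_mul, map_ofNat]
    ring
  have hres : residual V φ' a (φ + ψ) (u + (c * (M + 2)) • x ^ (M + 1)) =
      residual V φ' a φ u + (c * (M + 2)) • (x ^ (M + 1) * Z) -
        a • (u * (2 * φ * ψ + ψ ^ 2)) := by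
    have hal : along V ψ = (c * (M + 2)) • (x ^ (M + 1) * V i) := by
      rw [← alongDer_apply]
      simp only [ψ, Derivation.map_smul, Derivation.leibniz_pow, x, alongDer_apply, along_X]
      rw [← Nat.cast_smul_eq_nsmul ℝ, smul_smul]
      push_cast
      rfl
    rw [residual_add, hal]
    simp only [Z, MvPowerSeries.smul_eq_C_mul]
    ring
  refine ⟨c, c * (M + 2), ?_, ?_⟩
  · change residual V φ' a (φ + ψ) (u + (c * (M + 2)) • x ^ (M + 1)) ∈ _
    rw [hres]
    refine (orderGE n _).sub_mem ((orderGE n _).add_mem h ((orderGE n _).smul_mem _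
      (mul_mem_orderGE (M := M + 1) (hxk _) hZ))) ((orderGE n _).smul_mem _ ?_)
    simpa using (orderGE n _).add_mem (orderGE_anti (by omega) hY)
      ((orderGE n _).smul_mem (2 * c) (hxk (M + 3)))
  · change coeff _ (residual V φ' a (φ + ψ) (u + (c * (M + 2)) • x ^ (M + 1))) = 0
    have h₁ := hY (Finsupp.single i (M + 3)) (by simp)
    rw [map_sub, MvPowerSeries.coeff_smul, hcoeff_x, mul_one, sub_eq_zero] at h₁
    have h₂ : coeff (Finsupp.single i (M + 3)) (x ^ (M + 1) * Z) = 0 :=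
      (coeff_single_X_pow_mul i (M + 1) 2 Z).trans hZc
    rw [hres, map_sub, map_add, MvPowerSeries.coeff_smul, MvPowerSeries.coeff_smul, h₁, h₂]
    simp only [c]
    field_simp
    ring

/-- If a residual can be pushed to higher degree whenever its pure `xᵢ` term vanishes, then
`V(φ) = u (φ' + a φ²)` has a solution `φ = xᵢ + ⋯`, `u = 1 + ⋯`. -/
lemma exists_along_eq {S : Subalgebra ℝ (Series n)}
    (hS : IsClosedFor (orderGE n) (Subalgebra.toSubmodule S)) (hV : V ∈ orderGEVec n 1)
    (hVS : ∀ f ∈ S, along V f ∈ S) (hi : MvPowerSeries.X i ∈ S) {y : Series n} (hyS : y ∈ S)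
    (hφ'S : φ' ∈ S) (hy : y ∈ orderGE n 1) (hφ' : φ' - y ∈ orderGE n 2)
    (hVi : V i - φ' ∈ orderGE n 2) (hcoeff : coeff (Finsupp.single i 2) (V i - φ') = a)
    (ha : a ≠ 0)
    (H : ∀ N, ∀ Q ∈ S, Q ∈ orderGE n (N + 1) → coeff (Finsupp.single i (N + 1)) Q = 0 →
      ∃ g ∈ S, ∃ B ∈ S, g ∈ orderGE n N ∧ B ∈ orderGE n N ∧
        Q + along V (y * g) - y * B ∈ orderGE n (N + 2)) :
    ∃ φ ∈ S, ∃ u ∈ S, φ - MvPowerSeries.X i ∈ orderGE n 2 ∧ u - 1 ∈ orderGE n 1 ∧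
      along V φ = u * (φ' + a • φ ^ 2) := by
  -- The vanishing pure coefficient is part of the invariant because `H` needs it to start the next
  -- step.
  let Inv : ℕ → Series n × Series n → Prop := fun N p =>
    p.1 ∈ S ∧ p.2 ∈ S ∧ p.1 - MvPowerSeries.X i ∈ orderGE n 2 ∧ p.2 - 1 ∈ orderGE n 1 ∧
      residual V φ' a p.1 p.2 ∈ orderGE n (N + 2) ∧
      coeff (Finsupp.single i (N + 2)) (residual V φ' a p.1 p.2) = 0
  have hres : ∀ φ ∈ S, ∀ u ∈ S, residual V φ' a φ u ∈ S := fun φ hφ u hu =>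
    S.sub_mem (hVS φ hφ) (S.mul_mem hu (S.add_mem hφ'S (S.smul_mem (S.pow_mem hφ 2) a)))
  have hstep : ∀ N p, Inv N p → ∃ q, Inv (N + 1) q ∧ q.1 - p.1 ∈ orderGE n (N + 2) ∧
      q.2 - p.2 ∈ orderGE n (N + 1) := by
    rintro N ⟨φ, u⟩ ⟨hφS, huS, hφ, hu, hR, hRc⟩
    obtain ⟨g, hgS, B, hBS, hg, hB, hQ⟩ := H (N + 1) _ (hres φ hφS u huS) hR hRc
    have hφ₁ : φ ∈ orderGE n 1 := by
      simpa using (orderGE n 1).add_mem (orderGE_anti one_le_two hφ) (X_mem_orderGE i)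
    have hR' := residual_add_mem hy hφ' hφ₁ hg hB hQ
    have hyg : y * g ∈ orderGE n (N + 2) := by
      have := mul_mem_orderGE hy hg
      rwa [add_comm 1] at this
    have hφ₂ : φ + y * g - MvPowerSeries.X i ∈ orderGE n 2 := by
      rw [add_sub_right_comm]
      exact (orderGE n 2).add_mem hφ (orderGE_anti (by omega) hyg)
    have hu₂ : u + B - 1 ∈ orderGE n 1 := by
      rw [add_sub_right_comm]
      exact (orderGE n 1).add_mem hu (orderGE_anti (by omega) hB)
    obtain ⟨c, c', h₁, h₂⟩ := exists_residual_coeff_eq_zero hVi hcoeff ha hφ₂ hu₂ hR'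
    have hxk : ∀ k, (MvPowerSeries.X i : Series n) ^ k ∈ orderGE n k := fun k => by
      simpa using pow_mem_orderGE (X_mem_orderGE i) k
    have hc : c • (MvPowerSeries.X i : Series n) ^ (N + 2) ∈ orderGE n (N + 2) :=
      (orderGE n _).smul_mem _ (hxk _)
    have hc' : c' • (MvPowerSeries.X i : Series n) ^ (N + 1) ∈ orderGE n (N + 1) :=
      (orderGE n _).smul_mem _ (hxk _)
    refine ⟨(φ + y * g + c • MvPowerSeries.X i ^ (N + 2), u + B + c' • MvPowerSeries.X i ^ (N + 1)),
      ⟨S.add_mem (S.add_mem hφS (S.mul_mem hyS hgS)) (S.smul_mem (S.pow_mem hi _) c),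
      S.add_mem (S.add_mem huS hBS) (S.smul_mem (S.pow_mem hi _) c'), ?_, ?_, h₁, h₂⟩, ?_, ?_⟩
    · rw [add_sub_right_comm]
      exact (orderGE n 2).add_mem hφ₂ (orderGE_anti (by omega) hc)
    · rw [add_sub_right_comm]
      exact (orderGE n 1).add_mem hu₂ (orderGE_anti (by omega) hc')
    · simpa [add_assoc] using (orderGE n _).add_mem hyg hc
    · simpa [add_assoc] using (orderGE n _).add_mem hB hc'
  have hbase : Inv 0 (MvPowerSeries.X i, 1) := by
    have h₁ : residual V φ' a (MvPowerSeries.X i) 1 =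
        V i - φ' - a • (MvPowerSeries.X i : Series n) ^ 2 := by
      rw [residual, along_X, one_mul, sub_sub]
    refine ⟨hi, S.one_mem, by simp, by simp, ?_, ?_⟩
    · rw [h₁]
      exact (orderGE n 2).sub_mem hVi ((orderGE n 2).smul_mem _
        (by simpa using pow_mem_orderGE (X_mem_orderGE i) 2))
    · rw [h₁, map_sub, MvPowerSeries.coeff_smul]
      classical simp [hcoeff, MvPowerSeries.coeff_X_pow]
  choose! q hq using hstep
  let p : ℕ → Series n × Series n := fun N => Nat.rec (MvPowerSeries.X i, 1) (fun N p => q N p) N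
  have hp : ∀ N, Inv N (p N) := fun N => by
    induction N with
    | zero => exact hbase
    | succ N ih => exact (hq N _ ih).1
  obtain ⟨φ, hφ⟩ := isCompleteFiltration_orderGE.complete (fun N => (p N).1)
    fun N => orderGE_anti (by omega) (hq N _ (hp N)).2.1
  obtain ⟨u, hu⟩ := isCompleteFiltration_orderGE.complete (fun N => (p N).2)
    fun N => orderGE_anti (by omega) (hq N _ (hp N)).2.2
  refine ⟨φ, hS φ fun N => ⟨_, (hp N).1, hφ N⟩, u, hS u fun N => ⟨_, (hp N).2.1, hu N⟩, ?_, ?_, ?_⟩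
  · simpa using (orderGE n 2).add_mem (hφ 2) (hp 2).2.2.1
  · simpa using (orderGE n 1).add_mem (hu 1) (hp 1).2.2.2.1
  · refine isCompleteFiltration_orderGE.eq_of_sub_mem fun N => ?_
    have h₁ := residual_add V φ' a (p N).1 (p N).2 (φ - (p N).1) (u - (p N).2)
    rw [add_sub_cancel, add_sub_cancel] at h₁
    change residual V φ' a φ u ∈ _
    rw [h₁]
    refine (orderGE n N).sub_mem ((orderGE n N).add_mem (orderGE_anti (by omega)
      (hp N).2.2.2.2.1) ((orderGE n N).sub_mem (along_mem_orderGE_self hV (hφ N)) ?_))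
      ((orderGE n N).smul_mem _ (mul_mem_orderGE_right _ ?_))
    · rw [mul_comm]
      exact mul_mem_orderGE_right _ (hu N)
    · rw [sq, ← add_mul]
      exact mul_mem_orderGE_right _ (hφ N)

end Normalizing

end Series

/-! ### Coordinate changes and the triangular system of conjugacy equations -/

/-- A near-identity feed-forward formal map is invertible, and the change of coordinates by it is
`exp ρ(0, X)` for a feed-forward field `X`. -/
lemma exists_generator {n : ℕ} {φ : Fin n → Series n} (hφ : φ ∈ maps n) :
    ∃ X ∈ fieldsSub n, X ∈ orderGEVec n 2 ∧
      (∀ f, IsExp (orderGE n) (alongLin X) (MvPowerSeries.subst φ f) f) ∧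
      (∃ ψ ∈ maps n, AreInverse φ ψ) ∧ ∀ V, TurnsInto φ V (expRho 0 X V) := by
  have hF := isCompleteFiltration_orderGE (n := n)
  obtain ⟨Y, hY, hY₂, he⟩ := exists_isExp_X_eq hφ
  have hX := (fieldsSub n).neg_mem hY
  have hX₂ := (orderGEVec n 2).neg_mem hY₂
  have hneg : alongLin (-Y) = -alongLin Y := map_neg _ _
  have hT := raises_alongLin hX₂
  have hsubst := isExp_subst hY₂ he
  have hinv : ∀ f, IsExp (orderGE n) (alongLin (-Y)) (MvPowerSeries.subst φ f) f := fun f => by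
    rw [hneg]; exact (hsubst f).neg_comp hF (raises_alongLin hY₂)
  choose ψ hψ using fun i : Fin n => exists_isExp hF hT (MvPowerSeries.X i)
  have hψsubst := isExp_subst hX₂ hψ
  -- The sign is forced by exp ρ(0, X) V = exp(X) ∘ V ∘ exp(−X): the map attached to X is exp(−X) at
  -- the coordinates, and this has to be `φ`.
  refine ⟨-Y, hX, hX₂, hinv, ⟨ψ, fun i => ⟨?_, ?_⟩, fun i => ⟨?_, ?_⟩⟩, fun V i => ?_⟩
  · refine (hψ i).mem_of_isClosedFor (isClosedFor_ringFromAlg i) (fun f hf => ?_)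
      (X_mem_ringFromAlg i)
    rw [alongLin_apply]
    exact along_mem_ringFromAlg hX hf
  · have h := hψ i 2
    rw [expSum, sum_range_succ, sum_range_one] at h
    have h' := (orderGE n 2).add_mem h (hT 1 _ (X_mem_orderGE i))
    exact_mod_cast mem_orderGE_iff_le_order.1 (by simpa [sub_add_eq_sub_sub] using h')
  · have h := (hψ i).neg_comp hF hT
    rw [hneg, neg_neg] at h
    exact (hsubst _).unique hF h
  · have h := hinv (MvPowerSeries.X i)
    rw [(hsubst (MvPowerSeries.X i)).unique hF (he i)] at h
    exact (hψsubst _).unique hF h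
  · have h := isExp_along_expRho hX₂ (i := i) (f := φ i) (by rw [hneg, neg_neg]; exact he i) V
    have h' := h.neg_comp hF hT
    rw [hneg, neg_neg] at h'
    exact (hsubst _).unique hF h'

lemma eq_single_zero {d : Fin 3 →₀ ℕ} (h₁ : d 1 = 0) (h₂ : d 2 = 0) :
    d = Finsupp.single 0 d.degree := by
  ext j
  rw [Finsupp.degree_eq_sum, Fin.sum_univ_three]
  fin_cases j <;> simp [h₁, h₂]

lemma eq_single_one {d : Fin 3 →₀ ℕ} (h₀ : d 0 = 0) (h₂ : d 2 = 0) :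
    d = Finsupp.single 1 d.degree := by
  ext j
  rw [Finsupp.degree_eq_sum, Fin.sum_univ_three]
  fin_cases j <;> simp [h₀, h₂]

lemma eq_single_two {d : Fin 3 →₀ ℕ} (h₀ : d 0 = 0) (h₁ : d 1 = 0) :
    d = Finsupp.single 2 d.degree := by
  ext j
  rw [Finsupp.degree_eq_sum, Fin.sum_univ_three]
  fin_cases j <;> simp [h₀, h₁]

lemma mem_ringFromAlg_zero (f : Series 3) : f ∈ ringFromAlg (0 : Fin 3) :=
  fun _ _ j hj => absurd hj (Fin.not_lt_zero j)

lemma coeff_single_eq_zero {n : ℕ} {i j : Fin n} (hij : i < j) {k : ℕ} (hk : k ≠ 0) {f : Series n}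
    (hf : f ∈ ringFromAlg j) : coeff (Finsupp.single i k) f = 0 := by
  by_contra h
  exact hk (by simpa using hf _ h i hij)

/-- In `ℝ[[x₂, x₃]]`, terms of lowest degree other than the power of `x₂` are multiples
of `x₃`. -/
lemma exists_sub_X_two_mul_mem (N : ℕ) (Q : Series 3) (hQS : Q ∈ ringFromAlg (1 : Fin 3))
    (hQ : Q ∈ orderGE 3 (N + 1)) (hQc : coeff (Finsupp.single 1 (N + 1)) Q = 0) :
    ∃ B ∈ ringFromAlg (1 : Fin 3), B ∈ orderGE 3 N ∧
      Q - MvPowerSeries.X 2 * B ∈ orderGE 3 (N + 2) := by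
  refine ⟨divX 2 Q, divX_mem_ringFromAlg hQS, divX_mem_orderGE hQ, fun d hd => ?_⟩
  rw [coeff_sub_X_mul_divX]
  split_ifs with h₂
  · by_contra hne
    have h₁ : ¬ d.degree < N + 1 := fun h => hne (hQ d h)
    have h := eq_single_one (hQS d hne 0 (by decide)) h₂
    rw [show d.degree = N + 1 by omega] at h
    exact hne (h ▸ hQc)
  · rfl

/-- Terms of lowest degree other than the power of `x₁` are combinations of `x₂` and `x₃`. -/
lemma exists_sub_X_one_mul_mem (N : ℕ) (Q : Series 3)
    (hQ : Q ∈ orderGE 3 (N + 1)) (hQc : coeff (Finsupp.single 0 (N + 1)) Q = 0) :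
    ∃ A ∈ orderGE 3 N, ∃ B ∈ orderGE 3 N,
      Q - MvPowerSeries.X 2 * A - MvPowerSeries.X 1 * B ∈ orderGE 3 (N + 2) := by
  have hA : divX 2 Q ∈ orderGE 3 N := divX_mem_orderGE hQ
  have hQ' : Q - MvPowerSeries.X 2 * divX 2 Q ∈ orderGE 3 (N + 1) :=
    (orderGE 3 _).sub_mem hQ (by rw [add_comm]; exact mul_mem_orderGE (X_mem_orderGE 2) hA)
  refine ⟨divX 2 Q, hA, divX 1 (Q - MvPowerSeries.X 2 * divX 2 Q), divX_mem_orderGE hQ',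
    fun d hd => ?_⟩
  rw [coeff_sub_X_mul_divX, coeff_sub_X_mul_divX]
  split_ifs with h₁ h₂
  · by_contra hne
    have h' : ¬ d.degree < N + 1 := fun h => hne (hQ d h)
    have h := eq_single_zero h₁ h₂
    rw [show d.degree = N + 1 by omega] at h
    exact hne (h ▸ hQc)
  · rfl
  · rfl

/-- Solution of the conjugacy equations up to units. -/
lemma exists_maps_along_eq {F₁ F₂ F₃ : Series 3} (hF₂ : F₂ ∈ ringFromAlg (1 : Fin 3))
    (hF₃ : F₃ ∈ ringFromAlg (2 : Fin 3)) (h₁ : F₁ ∈ orderGE 3 2) (h₂ : F₂ ∈ orderGE 3 2)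
    (h₃ : F₃ ∈ orderGE 3 2) (ha : coeff (Finsupp.single 0 2) F₁ ≠ 0)
    (hb : coeff (Finsupp.single 1 2) F₂ ≠ 0) (hc : coeff (Finsupp.single 2 2) F₃ ≠ 0) :
    ∃ φ ∈ maps 3, ∃ u ∈ fieldsSub 3, (∀ i, u i - 1 ∈ orderGE 3 1) ∧
      ∀ i, along (system F₁ F₂ F₃) (φ i) = u i * MvPowerSeries.subst φ
        (normalForm (coeff (Finsupp.single 0 2) F₁) (coeff (Finsupp.single 1 2) F₂)
          (coeff (Finsupp.single 2 2) F₃) i) := by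
  let V := system F₁ F₂ F₃
  have hVfields : V ∈ fieldsSub 3 := mem_fieldsSub.2 fun i => by
    fin_cases i
    · exact mem_ringFromAlg_zero _
    · exact (ringFromAlg 1).add_mem (ringFromAlg_anti (by decide) (X_mem_ringFromAlg 2)) hF₂
    · exact hF₃
  have hV : V ∈ orderGEVec 3 1 := mem_orderGEVec.2 fun i => by
    fin_cases i
    · exact (orderGE 3 1).add_mem (X_mem_orderGE 1) (orderGE_anti one_le_two h₁)
    · exact (orderGE 3 1).add_mem (X_mem_orderGE 2) (orderGE_anti one_le_two h₂)
    · exact orderGE_anti one_le_two h₃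
  have hV0 : V 0 = MvPowerSeries.X 1 + F₁ := rfl
  have hV1 : V 1 = MvPowerSeries.X 2 + F₂ := rfl
  have hV2 : V 2 = F₃ := rfl
  have hX2 : (MvPowerSeries.X 2 : Series 3) ∈ ringFromAlg (1 : Fin 3) :=
    ringFromAlg_anti (by decide) (X_mem_ringFromAlg 2)
  obtain ⟨φ₂, hφ₂S, u₂, hu₂S, hφ₂, hu₂, he₂⟩ := exists_along_eq (V := V) (i := 1)
    (φ' := MvPowerSeries.X 2) (y := MvPowerSeries.X 2) (isClosedFor_ringFromAlg 1) hV
    (fun f hf => along_mem_ringFromAlg hVfields hf) (X_mem_ringFromAlg 1) hX2 hX2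
    (X_mem_orderGE 2) (by simp) (by rwa [hV1, add_sub_cancel_left])
    (by rw [hV1, add_sub_cancel_left]) hb (fun N Q hQS hQ hQc => by
      obtain ⟨B, hBS, hB, hQB⟩ := exists_sub_X_two_mul_mem N Q hQS hQ hQc
      -- In two variables the unit alone absorbs everything divisible by x₃.
      refine ⟨0, (ringFromAlg 1).zero_mem, B, hBS, (orderGE 3 N).zero_mem, hB, ?_⟩
      rwa [mul_zero, ← alongLin_apply, map_zero, add_zero])
  have hV0' : V 0 - φ₂ = F₁ - (φ₂ - MvPowerSeries.X 1) := by rw [hV0]; ring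
  obtain ⟨φ₁, hφ₁S, u₁, hu₁S, hφ₁, hu₁, he₁⟩ := exists_along_eq (V := V) (i := 0)
    (φ' := φ₂) (y := MvPowerSeries.X 1) (a := coeff (Finsupp.single 0 2) F₁)
    (isClosedFor_ringFromAlg 0) hV
    (fun f hf => mem_ringFromAlg_zero _) (X_mem_ringFromAlg 0) (mem_ringFromAlg_zero _)
    (mem_ringFromAlg_zero _) (X_mem_orderGE 1) hφ₂
    -- Replacing x₂ by `φ₂` leaves the coefficient of x₁² unchanged, since `φ₂` does not involve x₁.
    (by rw [hV0']; exact (orderGE 3 2).sub_mem h₁ hφ₂)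
    (by rw [hV0', map_sub, coeff_single_eq_zero (j := 1) (by decide) two_ne_zero
          ((ringFromAlg 1).sub_mem hφ₂S (X_mem_ringFromAlg 1)), sub_zero]) ha
    (fun N Q _ hQ hQc => by
      obtain ⟨A, hA, B, hB, hQAB⟩ := exists_sub_X_one_mul_mem N Q hQ hQc
      -- V(−x₂A) = −x₃A − F₂A − x₂V(A): the first term removes x₃A, the second has higher degree,
      -- and the third is compensated by the summand −V(A) in the unit.
      refine ⟨-A, mem_ringFromAlg_zero _, B - along V A, mem_ringFromAlg_zero _,
        (orderGE 3 N).neg_mem hA, (orderGE 3 N).sub_mem hB (along_mem_orderGE_self hV hA), ?_⟩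
      have h := (orderGE 3 (N + 2)).sub_mem hQAB
        (by rw [add_comm]; exact mul_mem_orderGE h₂ hA)
      convert h using 1
      have hneg : along V (-A) = -along V A := by simp only [← alongLin_apply, map_neg]
      rw [along_mul, along_X, hV1, hneg]
      ring)
  have hF₃eq : F₃ = MvPowerSeries.X 2 ^ 2 * divX 2 (divX 2 F₃) := by
    have h : ∀ f : Series 3, f ∈ ringFromAlg (2 : Fin 3) → f ∈ orderGE 3 1 →
        f = MvPowerSeries.X 2 * divX 2 f := fun f hf hf₁ => by
      rw [← sub_eq_zero]
      ext d
      rw [coeff_sub_X_mul_divX, map_zero]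
      split_ifs with hd
      · by_contra hne
        have h' := eq_single_two (hf d hne 0 (by decide)) (hf d hne 1 (by decide))
        have : d.degree = 0 := by rw [h'] at hd; simpa using hd
        exact hne (hf₁ d (by omega))
      · rfl
    rw [sq, mul_assoc, ← h _ (divX_mem_ringFromAlg hF₃) (divX_mem_orderGE h₃),
      ← h F₃ hF₃ (orderGE_anti one_le_two h₃)]
  let c := coeff (Finsupp.single 2 2) F₃
  let u₃ : Series 3 := c⁻¹ • divX 2 (divX 2 F₃)
  have hu₃ : u₃ - 1 ∈ orderGE 3 1 := by
    rw [mem_orderGE_one, map_sub, ← MvPowerSeries.coeff_zero_eq_constantCoeff_apply,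
      MvPowerSeries.coeff_smul, coeff_divX, coeff_divX, zero_add, ← Finsupp.single_add, map_one,
      inv_mul_cancel₀ hc, sub_self]
  let φ : Fin 3 → Series 3 := ![φ₁, φ₂, MvPowerSeries.X 2]
  have hφ : φ ∈ maps 3 := fun i => by
    fin_cases i
    · exact ⟨hφ₁S, by exact_mod_cast mem_orderGE_iff_le_order.1 hφ₁⟩
    · exact ⟨hφ₂S, by exact_mod_cast mem_orderGE_iff_le_order.1 hφ₂⟩
    · exact ⟨X_mem_ringFromAlg 2, by simp [φ]⟩
  have hsub : MvPowerSeries.HasSubst φ :=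
    MvPowerSeries.hasSubst_of_constantCoeff_zero fun i => mem_orderGE_one.1 <| by
      have := (orderGE 3 1).add_mem (orderGE_anti one_le_two
        (mem_orderGE_iff_le_order.2 (hφ i).2)) (X_mem_orderGE i)
      simpa using this
  have hterm : ∀ (t : ℝ) (i : Fin 3), MvPowerSeries.subst φ
      (MvPowerSeries.C t * (MvPowerSeries.X i : Series 3) ^ 2) = t • φ i ^ 2 := fun t i => by
    rw [← MvPowerSeries.smul_eq_C_mul, MvPowerSeries.subst_smul hsub,
      MvPowerSeries.subst_pow hsub, MvPowerSeries.subst_X hsub]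
  refine ⟨φ, hφ, ![u₁, u₂, u₃], mem_fieldsSub.2 fun i => ?_, fun i => ?_, fun i => ?_⟩
  · fin_cases i
    · exact hu₁S
    · exact hu₂S
    · exact (ringFromAlg 2).smul_mem (divX_mem_ringFromAlg (divX_mem_ringFromAlg hF₃)) _
  · fin_cases i
    · exact hu₁
    · exact hu₂
    · exact hu₃
  · fin_cases i
    · change along V φ₁ = u₁ * MvPowerSeries.subst φ (MvPowerSeries.X 1 + MvPowerSeries.C _ * _)
      rw [MvPowerSeries.subst_add hsub, hterm, MvPowerSeries.subst_X hsub]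
      exact he₁
    · change along V φ₂ = u₂ * MvPowerSeries.subst φ (MvPowerSeries.X 2 + MvPowerSeries.C _ * _)
      rw [MvPowerSeries.subst_add hsub, hterm, MvPowerSeries.subst_X hsub]
      exact he₂
    · change along V (MvPowerSeries.X 2) = u₃ * MvPowerSeries.subst φ (MvPowerSeries.C c * _)
      rw [hterm, along_X, hV2]
      refine hF₃eq.trans ?_
      change _ = c⁻¹ • divX 2 (divX 2 F₃) * c • (MvPowerSeries.X 2 : Series 3) ^ 2
      rw [smul_mul_smul_comm, inv_mul_cancel₀ hc, one_smul, mul_comm]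

/-! ### Invariance of the square coefficients -/

/-- The linear part of the systems under consideration, together with the coefficients of the
squares `xᵢ²` in the `i`-th components. -/
def HasSquareCoeffs (q : Fin 3 → ℝ) (V : Fin 3 → Series 3) : Prop :=
  V - system 0 0 0 ∈ orderGEVec 3 2 ∧ ∀ i, coeff (Finsupp.single i 2) (V i) = q i

lemma coeff_single_mul_X {n : ℕ} {i j : Fin n} (hij : i ≠ j) (k : ℕ) (f : Series n) :
    coeff (Finsupp.single i k) (f * MvPowerSeries.X j) = 0 := by
  classical
  rw [mul_comm, MvPowerSeries.X, MvPowerSeries.coeff_monomial_mul, if_neg]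
  rw [Finsupp.single_le_iff, Finsupp.single_eq_of_ne hij.symm]
  omega

/-- With L the linear part, r ⋆ L and L(Xᵢ) consist of multiples of variables other than xᵢ, since
∂ⱼXᵢ = 0 for j < i, while X(Lᵢ) is Xᵢ₊₁ or 0 and is free of xᵢ. -/
lemma coeff_rho_linear {r X : Fin 3 → Series 3} (hX : X ∈ fieldsSub 3) (i : Fin 3) :
    coeff (Finsupp.single i 2) (rho r X (system 0 0 0) i) = 0 := by
  have hX' := mem_fieldsSub.1 hX
  have hal : ∀ f : Series 3, along (system 0 0 0) f =
      MvPowerSeries.pderiv ℝ 0 f * MvPowerSeries.X 1 +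
        MvPowerSeries.pderiv ℝ 1 f * MvPowerSeries.X 2 := fun f => by
    simp [along, Fin.sum_univ_three, system, mul_comm]
  rw [rho, bracket, hal, map_add, map_sub, map_add]
  fin_cases i
  · have h : system 0 0 0 0 = (MvPowerSeries.X 1 : Series 3) := add_zero _
    simp only [Fin.zero_eta]
    rw [h, along_X, coeff_single_mul_X (by decide), coeff_single_mul_X (by decide),
      coeff_single_mul_X (by decide), coeff_single_eq_zero (by decide) two_ne_zero (hX' 1)]
    simp
  · have h : system 0 0 0 1 = (MvPowerSeries.X 2 : Series 3) := add_zero _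
    simp only [Fin.mk_one]
    rw [h, along_X, coeff_single_mul_X (by decide), pderiv_eq_zero_of_lt (hX' 1) (by decide),
      zero_mul, map_zero, coeff_single_mul_X (by decide), coeff_single_eq_zero (by decide) two_ne_zero (hX' 2)]
    simp
  · have h : system 0 0 0 2 = (0 : Series 3) := rfl
    simp only [Fin.reduceFinMk]
    rw [h, pderiv_eq_zero_of_lt (hX' 2) (by decide), pderiv_eq_zero_of_lt (hX' 2) (by decide),
      ← alongLin_apply]
    simp

lemma HasSquareCoeffs.outerStep {q : Fin 3 → ℝ} {V V' : Fin 3 → Series 3}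
    (h : HasSquareCoeffs q V) (hVV' : OuterStep V V') : HasSquareCoeffs q V' := by
  obtain ⟨r, hr, X, hX, rfl⟩ := hVV'
  have hF := isCompleteFiltration_orderGEVec (n := 3)
  have hX₂ : X ∈ orderGEVec 3 2 := mem_orderGEVec.2 fun i => mem_orderGE_iff_le_order.2 (hX.2 i)
  have hr₁ : r ∈ orderGEVec 3 1 := mem_orderGEVec.2 fun i => mem_orderGE_one.2 (hr i).2
  have hT := raises_rhoLin hr₁ hX₂
  have hlin : system 0 0 0 ∈ orderGEVec 3 1 := mem_orderGEVec.2 fun i => by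
    fin_cases i
    · exact (orderGE 3 1).add_mem (X_mem_orderGE 1) (orderGE 3 1).zero_mem
    · exact (orderGE 3 1).add_mem (X_mem_orderGE 2) (orderGE 3 1).zero_mem
    · exact (orderGE 3 1).zero_mem
  have hV₁ : V ∈ orderGEVec 3 1 := by
    simpa using (orderGEVec 3 1).add_mem (hF.anti one_le_two h.1) hlin
  -- As `V` has order at least 1 and ρ raises the order, the terms with k ≥ 2 do not reach degree 2.
  have hexp : expRho r X V - V - rho r X V ∈ orderGEVec 3 3 := by
    have h₁ := isExp_expRho hr₁ hX₂ V 3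
    rw [expSum, sum_range_succ, sum_range_succ, sum_range_one] at h₁
    have h₂ := (orderGEVec 3 3).smul_mem (((Nat.factorial 2 : ℕ) : ℝ)⁻¹) (hT.pow_mem hV₁ 2)
    have h₃ := (orderGEVec 3 3).add_mem h₁ h₂
    rw [sub_add_eq_sub_sub, sub_add_cancel] at h₃
    simpa [sub_add_eq_sub_sub, rhoLin_apply] using h₃
  refine ⟨?_, fun i => ?_⟩
  · have := (orderGEVec 3 2).add_mem ((orderGEVec 3 2).add_mem
      (hF.anti (by omega : 2 ≤ 3) hexp) (hT 1 V hV₁)) h.1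
    rw [rhoLin_apply] at this
    convert this using 1
    abel
  -- The part of `V` of order at least 2 is sent by ρ to order at least 3, so only the linear part
  -- can affect degree 2.
  · have h₁ := mem_orderGEVec.1 ((orderGEVec 3 3).add_mem hexp (hT 2 _ h.1)) i
      (Finsupp.single i 2) (by simp)
    rw [map_sub, rhoLin_apply, rhoLin_apply] at h₁
    simp only [Pi.add_apply, Pi.sub_apply, map_add, map_sub] at h₁
    rw [coeff_rho_linear (mem_fieldsSub_iff_mem_fields.2 hX.1), h.2 i] at h₁
    linarith

lemma HasSquareCoeffs.reflTransGen {q : Fin 3 → ℝ} {V V' : Fin 3 → Series 3}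
    (h : HasSquareCoeffs q V) (hVV' : Relation.ReflTransGen OuterStep V V') :
    HasSquareCoeffs q V' := by
  induction hVV' with
  | refl => exact h
  | tail _ hstep ih => exact ih.outerStep hstep

lemma hasSquareCoeffs_system {F₁ F₂ F₃ : Series 3} (h₁ : F₁ ∈ orderGE 3 2)
    (h₂ : F₂ ∈ orderGE 3 2) (h₃ : F₃ ∈ orderGE 3 2) :
    HasSquareCoeffs ![coeff (Finsupp.single 0 2) F₁, coeff (Finsupp.single 1 2) F₂,
      coeff (Finsupp.single 2 2) F₃] (system F₁ F₂ F₃) := by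
  classical
  have hX : ∀ i j : Fin 3, coeff (Finsupp.single i 2) (MvPowerSeries.X j : Series 3) = 0 :=
    fun i j => by
      rw [MvPowerSeries.coeff_X, if_neg]
      intro h
      have := congrArg Finsupp.degree h
      simp at this
  refine ⟨mem_orderGEVec.2 fun i => ?_, fun i => ?_⟩
  · fin_cases i
    · simpa [system] using h₁
    · simpa [system] using h₂
    · simpa [system] using h₃
  · fin_cases i <;> simp [system, hX]

end FeedForward

end

theorem mainTheorem1
    (F₁ F₂ F₃ : FeedForward.Series 3)
    (hF₂ : F₂ ∈ FeedForward.ringFrom (1 : Fin 3))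
    (hF₃ : F₃ ∈ FeedForward.ringFrom (2 : Fin 3))
    (hF₁_order : 2 ≤ F₁.order) (hF₂_order : 2 ≤ F₂.order) (hF₃_order : 2 ≤ F₃.order)
    (a₂ b₂ c₂ : ℝ)
    (ha : MvPowerSeries.coeff (Finsupp.single 0 2) F₁ = a₂)
    (hb : MvPowerSeries.coeff (Finsupp.single 1 2) F₂ = b₂)
    (hc : MvPowerSeries.coeff (Finsupp.single 2 2) F₃ = c₂)
    (ha_ne : a₂ ≠ 0) (hb_ne : b₂ ≠ 0) (hc_ne : c₂ ≠ 0) :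
    (∃ X ∈ FeedForward.fieldsOne 3, ∃ r ∈ FeedForward.orbitalOne 3,
      ∃ φ ∈ FeedForward.maps 3, ∃ ψ ∈ FeedForward.maps 3,
        FeedForward.AreInverse φ ψ ∧
        (∀ V ∈ FeedForward.fields 3, FeedForward.TurnsInto φ V (FeedForward.expRho 0 X V)) ∧
        Set.BijOn (fun V => FeedForward.expRho r 0 (FeedForward.expRho 0 X V))
          (FeedForward.fields 3) (FeedForward.fields 3) ∧
        FeedForward.expRho r 0 (FeedForward.expRho 0 X (FeedForward.system F₁ F₂ F₃)) =
          FeedForward.normalForm a₂ b₂ c₂) ∧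
    (∀ a b c : ℝ,
      Relation.ReflTransGen FeedForward.OuterStep (FeedForward.system F₁ F₂ F₃)
        (FeedForward.normalForm a b c) → a = a₂ ∧ b = b₂ ∧ c = c₂) := by
  open FeedForward in
  have h₁ : F₁ ∈ orderGE 3 2 := mem_orderGE_iff_le_order.2 hF₁_order
  have h₂ : F₂ ∈ orderGE 3 2 := mem_orderGE_iff_le_order.2 hF₂_order
  have h₃ : F₃ ∈ orderGE 3 2 := mem_orderGE_iff_le_order.2 hF₃_order
  subst ha hb hc
  refine ⟨?_, fun a b c h => ?_⟩
  · obtain ⟨φ, hφ, u, hu, hu₁, he⟩ :=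
      exists_maps_along_eq hF₂ hF₃ h₁ h₂ h₃ ha_ne hb_ne hc_ne
    obtain ⟨X, hX, hX₂, hinv, ⟨ψ, hψ, hφψ⟩, hturn⟩ := exists_generator hφ
    have hF := isCompleteFiltration_orderGE (n := 3)
    -- `w i` is `u i` written in the new coordinates. Exponentiating V(φᵢ) = uᵢ · (Wᵢ ∘ φ) shows
    -- that the transformed field is `w` times the normal form.
    choose w hw using fun i => exists_isExp hF (raises_alongLin hX₂) (u i)
    have hwfields : w ∈ fieldsSub 3 := mem_fieldsSub.2 fun i =>
      (hw i).mem_of_isClosedFor (isClosedFor_ringFromAlg i)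
        (fun f hf => by rw [alongLin_apply]; exact along_mem_ringFromAlg hX hf)
        (mem_fieldsSub.1 hu i)
    have hw₁ : ∀ i, w i - 1 ∈ orderGE 3 1 := fun i => by
      simpa [expSum] using (orderGE 3 1).add_mem (hw i 1) (hu₁ i)
    obtain ⟨r, hr, hr₁, hrw⟩ := exists_expRho_one_eq hwfields hw₁
    have hbij := (bijOn_expRho hr₁ (orderGEVec 3 2).zero_mem hr (fieldsSub 3).zero_mem).comp
      (bijOn_expRho (orderGEVec 3 1).zero_mem hX₂ (fieldsSub 3).zero_mem hX)
    refine ⟨X, ⟨mem_fieldsSub_iff_mem_fields.1 hX,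
      fun i => mem_orderGE_iff_le_order.1 (mem_orderGEVec.1 hX₂ i)⟩, r,
      fun i => ⟨mem_fieldsSub.1 hr i, mem_orderGE_one.1 (mem_orderGEVec.1 hr₁ i)⟩,
      φ, hφ, ψ, hψ, hφψ, fun V _ => hturn V, hbij, ?_⟩
    convert hrw (normalForm _ _ _) using 2
    funext i
    have h := hinv (expRho 0 X (system F₁ F₂ F₃) i)
    rw [hturn _ i, he i] at h
    exact h.unique hF ((hw i).mul hX₂ (hinv _))
  · have hsq : ∀ (t : ℝ) (i : Fin 3),
        MvPowerSeries.C t * (MvPowerSeries.X i : Series 3) ^ 2 ∈ orderGE 3 2 := fun t i =>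
      mul_mem_orderGE_right _ (by simpa using pow_mem_orderGE (X_mem_orderGE i) 2)
    have hcoeff : ∀ (t : ℝ) (i : Fin 3), MvPowerSeries.coeff (Finsupp.single i 2)
        (MvPowerSeries.C t * (MvPowerSeries.X i : Series 3) ^ 2) = t := fun t i => by
      classical simp [MvPowerSeries.coeff_X_pow]
    have hend := hasSquareCoeffs_system (hsq a 0) (hsq b 1) (hsq c 2)
    have hstart := (hasSquareCoeffs_system h₁ h₂ h₃).reflTransGen h
    have hq := fun i => (hend.2 i).symm.trans (hstart.2 i)
    exact ⟨by simpa [hcoeff] using hq 0, by simpa [hcoeff] using hq 1,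
      by simpa [hcoeff] using hq 2⟩
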